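/- Let $p>1$ and consider, for $\mu>0$ and $v\in C^2([0,1])$, the problem $$-v''(x)=\mu\,(v(x)^p+v(x)\sin^2v(x)),\quad v(x)>0\quad(0<x<1),\qquad v(0)=v(1)=0. \tag{P}$$ For a real number $\alpha>0$ put $$C_0=\int_0^1\frac{ds}{\sqrt{1-s^{p+1}}},\qquad C_1=-\frac{p+1}{8}\int_0^1\frac{1-s^2}{(1-s^{p+1})^{3/2}}\,ds,\qquad C_2=\frac{3(p+1)^2}{128}\int_0^1\frac{(1-s^2)^2}{(1-s^{p+1})^{5/2}}\,ds,$$ $$C_{11}=\frac{2}{p+1}\int_0^{\pi/2}\cos(2\alpha\sin^{2/(p+1)}\theta)\,\sin^{(3-p)/(p+1)}\theta\,d\theta,$$ $$C_{12}=\frac{p-1}{2(p+1)}\int_0^{\pi/2}\bigl(\sin2\alpha-\sin(2\alpha\sin^{2/(p+1)}\theta)\bigr)\sin^{(1-p)/(p+1)}\theta\,d\theta+\frac{p+1}{4}\int_0^1\frac{1-s}{(1-s^{p+1})^{3/2}}\sin(2\alpha s)\,ds,$$ $$C_{21}=-\frac1{p+1}\int_0^{\pi/2}\sin(2\alpha\sin^{2/(p+1)}\theta)\,\sin^{(3-p)/(p+1)}\theta\,d\theta,$$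 $$C_3=-\frac{3(p+1)^2}{32}\int_0^1\Bigl(\int_0^s\frac{1-y^2}{(1-y^{p+1})^{5/2}}\,dy\Bigr)\cos(2\alpha s)\,ds,$$ $$E_0=\int_0^1\sqrt{1-s^{p+1}}\,ds,\qquad E_1=\frac{p+1}{8}\int_0^1\frac{1-s^2}{\sqrt{1-s^{p+1}}}\,ds,\qquad E_4=-\frac{(p+1)^2}{128}\int_0^1\frac{(1-s^2)^2}{(1-s^{p+1})^{3/2}}\,ds,$$ $$E_2=-\frac14\int_0^{\pi/2}\bigl(\sin2\alpha-\sin^{2/(p+1)}\theta\,\sin(2\alpha\sin^{2/(p+1)}\theta)\bigr)\sin^{(1-p)/(p+1)}\theta\,d\theta,$$ and $$G_0=C_0E_0,\qquad G_1=C_0E_1+\bigl(C_1+\tfrac12C_{11}\bigr)E_0,\qquad G_2=\tfrac12(C_{12}+C_{21})E_0+C_0E_2,$$ $$G_4=(C_2+C_3)E_0+C_0E_4+\bigl(C_1+\tfrac12C_{11}\bigr)E_1$$ (so $G_1,G_2,G_4$ depend on $p$ and $\alpha$, and $G_0$ on $p$ only). **Theorem 1.5.** Let $1<p\le2$. For every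 $\alpha>0$ problem (P) has a solution pair $(\mu,v_\alpha)$ with $\|v_\alpha\|_\infty=\alpha$. Moreover, the following hold for every such solution, with a remainder that depends only on $p$ and $\alpha$. (i) If $1<p<2$, then as $\alpha\to\infty$, $$\|v_\alpha'\|_2^2=4\alpha^2\bigl\{G_0+G_1\alpha^{1-p}+G_4\alpha^{2(1-p)}+G_2\alpha^{-p}+o(\alpha^{2(1-p)})\bigr\}.$$ (ii) If $p=2$, then as $\alpha\to\infty$, $$\|v_\alpha'\|_2^2=4\alpha^2\bigl\{G_0+G_1\alpha^{-1}+(G_2+G_4)\alpha^{-2}+o(\alpha^{-2})\bigr\}.$$ -/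

import Mathlib

open Set Filter Topology Asymptotics

namespace OscBif

/-- `(μ, v)` is a solution pair of
`-v'' = μ (v ^ p + v sin² v)` and `v > 0` on `(0,1)`, `v(0) = v(1) = 0`,
with `μ > 0` and `v` of class `C²` on the closed interval `[0,1]`.
Only the values of `v` on `[0,1]` matter. -/
structure IsSolution (p μ : ℝ) (v : ℝ → ℝ) : Prop where
  mu_pos : 0 < μ
  contDiffOn : ContDiffOn ℝ 2 v (Icc 0 1)
  equation : ∀ x ∈ Ioo (0 : ℝ) 1,
    -deriv (deriv v) x = μ * (v x ^ p + v x * Real.sin (v x) ^ 2)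
  pos : ∀ x ∈ Ioo (0 : ℝ) 1, 0 < v x
  left : v 0 = 0
  right : v 1 = 0

/-- `‖v‖_∞ = α` on `[0,1]`. -/
def HasSupNorm (v : ℝ → ℝ) (α : ℝ) : Prop :=
  IsLUB ((fun x => |v x|) '' Icc (0 : ℝ) 1) α

/-- `‖v'‖₂²` on `(0,1)`. -/
noncomputable def energy (v : ℝ → ℝ) : ℝ :=
  ∫ x in (0 : ℝ)..1, (deriv v x) ^ 2

/-! The coefficients. Those that oscillate take `α` as an argument. -/

noncomputable def C0 (p : ℝ) : ℝ :=
  ∫ s in (0 : ℝ)..1, 1 / √(1 - s ^ (p + 1))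

noncomputable def C1 (p : ℝ) : ℝ :=
  -((p + 1) / 8) * ∫ s in (0 : ℝ)..1, (1 - s ^ 2) / (1 - s ^ (p + 1)) ^ (3 / 2 : ℝ)

noncomputable def C11 (p α : ℝ) : ℝ :=
  2 / (p + 1) * ∫ θ in (0 : ℝ)..(Real.pi / 2),
    Real.cos (2 * α * Real.sin θ ^ (2 / (p + 1))) * Real.sin θ ^ ((3 - p) / (p + 1))

noncomputable def C12 (p α : ℝ) : ℝ :=
  (p - 1) / (2 * (p + 1)) * (∫ θ in (0 : ℝ)..(Real.pi / 2),
    (Real.sin (2 * α) - Real.sin (2 * α * Real.sin θ ^ (2 / (p + 1)))) *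
      Real.sin θ ^ ((1 - p) / (p + 1)))
  + (p + 1) / 4 * ∫ s in (0 : ℝ)..1,
    (1 - s) / (1 - s ^ (p + 1)) ^ (3 / 2 : ℝ) * Real.sin (2 * α * s)

noncomputable def C21 (p α : ℝ) : ℝ :=
  -(1 / (p + 1)) * ∫ θ in (0 : ℝ)..(Real.pi / 2),
    Real.sin (2 * α * Real.sin θ ^ (2 / (p + 1))) * Real.sin θ ^ ((3 - p) / (p + 1))

noncomputable def C2 (p : ℝ) : ℝ :=
  3 * (p + 1) ^ 2 / 128 *
    ∫ s in (0 : ℝ)..1, (1 - s ^ 2) ^ 2 / (1 - s ^ (p + 1)) ^ (5 / 2 : ℝ)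

noncomputable def C3 (p α : ℝ) : ℝ :=
  -(3 / 32) * (p + 1) ^ 2 * ∫ s in (0 : ℝ)..1,
    (∫ y in (0 : ℝ)..s, (1 - y ^ 2) / (1 - y ^ (p + 1)) ^ (5 / 2 : ℝ)) * Real.cos (2 * α * s)

noncomputable def E0 (p : ℝ) : ℝ :=
  ∫ s in (0 : ℝ)..1, √(1 - s ^ (p + 1))

noncomputable def E1 (p : ℝ) : ℝ :=
  (p + 1) / 8 * ∫ s in (0 : ℝ)..1, (1 - s ^ 2) / √(1 - s ^ (p + 1))

noncomputable def E2 (p α : ℝ) : ℝ :=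
  -(1 / 4) * ∫ θ in (0 : ℝ)..(Real.pi / 2),
    (Real.sin (2 * α) -
        Real.sin θ ^ (2 / (p + 1)) * Real.sin (2 * α * Real.sin θ ^ (2 / (p + 1)))) *
      Real.sin θ ^ ((1 - p) / (p + 1))

noncomputable def E4 (p : ℝ) : ℝ :=
  -((p + 1) ^ 2 / 128) *
    ∫ s in (0 : ℝ)..1, (1 - s ^ 2) ^ 2 / (1 - s ^ (p + 1)) ^ (3 / 2 : ℝ)

noncomputable def G0 (p : ℝ) : ℝ := C0 p * E0 p

noncomputable def G1 (p α : ℝ) : ℝ :=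
  C0 p * E1 p + (C1 p + 1 / 2 * C11 p α) * E0 p

noncomputable def G2 (p α : ℝ) : ℝ :=
  1 / 2 * (C12 p α + C21 p α) * E0 p + C0 p * E2 p α

noncomputable def G4 (p α : ℝ) : ℝ :=
  (C2 p + C3 p α) * E0 p + C0 p * E4 p + (C1 p + 1 / 2 * C11 p α) * E1 p

end OscBif

namespace OscBif

open MeasureTheory

theorem intervalIntegral_eq_setIntegral_Ioo {a b : ℝ} (hab : a ≤ b) (f : ℝ → ℝ) :
    ∫ s in a..b, f s = ∫ s in Ioo a b, f s := by
  rw [intervalIntegral.integral_of_le hab, integral_Ioc_eq_integral_Ioo]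

/-! ### The Riemann–Lebesgue lemma in trigonometric form -/

theorem tendsto_setIntegral_trig {ψ : ℝ → ℝ} (hψ : IntegrableOn ψ (Ioo 0 1)) :
    Tendsto (fun α : ℝ => ∫ s in Ioo (0 : ℝ) 1, ψ s * Real.cos (2 * α * s)) atTop (𝓝 0) ∧
    Tendsto (fun α : ℝ => ∫ s in Ioo (0 : ℝ) 1, ψ s * Real.sin (2 * α * s)) atTop (𝓝 0) := by
  have h := Real.tendsto_integral_exp_smul_cocompact
    (fun s => (((Ioo (0 : ℝ) 1).indicator ψ s : ℝ) : ℂ))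
  have hlim : Tendsto (fun α : ℝ => -(α / Real.pi)) atTop (cocompact ℝ) := by
    refine Tendsto.mono_right ?_ atBot_le_cocompact
    exact tendsto_neg_atTop_atBot.comp (tendsto_id.atTop_div_const Real.pi_pos)
  have h2 := h.comp hlim
  have key : ∀ α : ℝ, (∫ v : ℝ, (Real.fourierChar (-(v * (-(α / Real.pi)))) : Circle) •
      (((Ioo (0 : ℝ) 1).indicator ψ v : ℝ) : ℂ)) =
      ∫ s in Ioo (0 : ℝ) 1, ((ψ s : ℂ) * Complex.exp ((2 * α * s : ℝ) * Complex.I)) := by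
    intro α
    rw [← integral_indicator measurableSet_Ioo]
    congr 1
    ext s
    by_cases hs : s ∈ Ioo (0 : ℝ) 1
    · simp only [indicator_of_mem hs, Circle.smul_def, Real.fourierChar_apply, smul_eq_mul]
      rw [mul_comm]
      congr 3
      push_cast
      have : (Real.pi : ℂ) ≠ 0 := by exact_mod_cast Real.pi_ne_zero
      field_simp
    · simp [indicator_of_notMem hs]
  have hint : ∀ α : ℝ, IntegrableOn
      (fun s : ℝ => ((ψ s : ℂ) * Complex.exp ((2 * α * s : ℝ) * Complex.I))) (Ioo 0 1) := by
    intro α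
    refine Integrable.mul_bdd (c := 1) hψ.ofReal ?_ ?_
    · exact Continuous.aestronglyMeasurable (by fun_prop)
    · exact ae_of_all _ fun s => (Complex.norm_exp_ofReal_mul_I _).le
  have hre := (Complex.continuous_re.tendsto 0).comp h2
  have him := (Complex.continuous_im.tendsto 0).comp h2
  simp only [Complex.zero_re, Complex.zero_im] at hre him
  refine ⟨hre.congr fun α => ?_, him.congr fun α => ?_⟩
  · simp only [Function.comp_apply]
    rw [key α]
    have := integral_re (hint α)
    simp only [RCLike.re_to_complex] at this
    rw [← this]
    refine integral_congr_ae (ae_of_all _ fun s => ?_)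
    simp only [Complex.re_ofReal_mul, Complex.exp_ofReal_mul_I_re]
  · simp only [Function.comp_apply]
    rw [key α]
    have := integral_im (hint α)
    simp only [RCLike.im_to_complex] at this
    rw [← this]
    refine integral_congr_ae (ae_of_all _ fun s => ?_)
    simp only [Complex.im_ofReal_mul, Complex.exp_ofReal_mul_I_im]

/-! ### The weight `(1 - s ^ (p + 1)) ^ (-1/2)` -/

/-- `1 - s ^ (p + 1)` -/
noncomputable def gap (p s : ℝ) : ℝ := 1 - s ^ (p + 1)

/-- `1 / √(1 - s ^ (p + 1))` -/
noncomputable def weight (p s : ℝ) : ℝ := 1 / √(gap p s)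

theorem one_sub_sq_le_gap {p s : ℝ} (hp : 1 < p) (hs : s ∈ Ioo (0 : ℝ) 1) :
    1 - s ^ 2 ≤ gap p s := by
  have : s ^ (p + 1) ≤ s ^ (2 : ℝ) :=
    Real.rpow_le_rpow_of_exponent_ge hs.1 hs.2.le (by linarith)
  rw [Real.rpow_two] at this
  unfold gap; linarith

theorem one_sub_le_gap {p s : ℝ} (hp : 1 < p) (hs : s ∈ Ioo (0 : ℝ) 1) :
    1 - s ≤ gap p s := by
  have := one_sub_sq_le_gap hp hs
  nlinarith [hs.1, hs.2]

theorem gap_pos {p s : ℝ} (hp : 1 < p) (hs : s ∈ Ioo (0 : ℝ) 1) : 0 < gap p s :=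
  (sub_pos.2 hs.2).trans_le (one_sub_le_gap hp hs)

theorem gap_le_one {p s : ℝ} (hs : s ∈ Ioo (0 : ℝ) 1) : gap p s ≤ 1 := by
  have := Real.rpow_nonneg hs.1.le (p + 1)
  unfold gap; linarith

theorem weight_pos {p s : ℝ} (hp : 1 < p) (hs : s ∈ Ioo (0 : ℝ) 1) : 0 < weight p s :=
  one_div_pos.2 (Real.sqrt_pos.2 (gap_pos hp hs))

theorem continuous_gap {p : ℝ} (hp : 1 < p) : Continuous (gap p) :=
  continuous_const.sub (Real.continuous_rpow_const (by linarith))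

theorem continuousOn_weight {p : ℝ} (hp : 1 < p) : ContinuousOn (weight p) (Ioo 0 1) :=
  continuousOn_const.div (continuous_gap hp).continuousOn.sqrt
    fun _ hs => (Real.sqrt_pos.2 (gap_pos hp hs)).ne'

theorem hasDerivAt_gap {p s : ℝ} (hs : 0 < s) :
    HasDerivAt (gap p) (-((p + 1) * s ^ p)) s := by
  have := (Real.hasDerivAt_rpow_const (x := s) (p := p + 1) (Or.inl hs.ne')).const_sub 1
  simpa using! this

theorem integrableOn_rpow_one_sub {r : ℝ} (hr : -1 < r) :
    IntegrableOn (fun s : ℝ => (1 - s) ^ r) (Ioo 0 1) := by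
  have h := (intervalIntegral.intervalIntegrable_rpow' (a := 0) (b := 1) hr).comp_sub_left 1
  simp only [sub_zero, sub_self] at h
  exact (intervalIntegrable_iff_integrableOn_Ioo_of_le zero_le_one).1 h.symm

theorem weight_le {p s : ℝ} (hp : 1 < p) (hs : s ∈ Ioo (0 : ℝ) 1) :
    weight p s ≤ (1 - s) ^ (-(1 / 2) : ℝ) := by
  rw [Real.rpow_neg (sub_pos.2 hs.2).le, ← Real.sqrt_eq_rpow, weight, one_div]
  exact inv_anti₀ (Real.sqrt_pos.2 (sub_pos.2 hs.2)) (Real.sqrt_le_sqrt (one_sub_le_gap hp hs))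

theorem integrableOn_weight {p : ℝ} (hp : 1 < p) : IntegrableOn (weight p) (Ioo 0 1) := by
  refine (integrableOn_rpow_one_sub (r := -(1 / 2)) (by norm_num)).mono'
    ((continuousOn_weight hp).aestronglyMeasurable measurableSet_Ioo) ?_
  refine ae_restrict_of_forall_mem measurableSet_Ioo fun s hs => ?_
  rw [Real.norm_of_nonneg (weight_pos hp hs).le]
  exact weight_le hp hs

theorem integrableOn_mul_weight {p : ℝ} (hp : 1 < p) {b : ℝ → ℝ} (hb : ContinuousOn b (Ioo 0 1))
    {C : ℝ} (hC : ∀ s ∈ Ioo (0 : ℝ) 1, |b s| ≤ C) :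
    IntegrableOn (fun s => b s * weight p s) (Ioo 0 1) :=
  Integrable.bdd_mul (c := C) (integrableOn_weight hp) (hb.aestronglyMeasurable measurableSet_Ioo)
    (ae_restrict_of_forall_mem measurableSet_Ioo hC)

theorem gap_rpow_three_halves {p s : ℝ} (hp : 1 < p) (hs : s ∈ Ioo (0 : ℝ) 1) (x : ℝ) :
    x / gap p s ^ (3 / 2 : ℝ) = x / gap p s * weight p s := by
  have h := gap_pos hp hs
  rw [show (3 / 2 : ℝ) = 1 + 1 / 2 by norm_num, Real.rpow_add h, Real.rpow_one,
    ← Real.sqrt_eq_rpow, weight]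
  have := (Real.sqrt_pos.2 h).ne'
  field_simp

theorem gap_rpow_five_halves {p s : ℝ} (hp : 1 < p) (hs : s ∈ Ioo (0 : ℝ) 1) (x : ℝ) :
    x / gap p s ^ (5 / 2 : ℝ) = x / gap p s ^ 2 * weight p s := by
  have h := gap_pos hp hs
  rw [show (5 / 2 : ℝ) = 2 + 1 / 2 by norm_num, Real.rpow_add h, Real.rpow_two,
    ← Real.sqrt_eq_rpow, weight]
  have := (Real.sqrt_pos.2 h).ne'
  field_simp

theorem sqrt_gap (p s : ℝ) :
    √(gap p s) = gap p s * weight p s := by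
  rw [weight, mul_one_div, Real.div_sqrt]

/-- The change of variables `s = sin θ ^ (2 / (p + 1))`. -/
theorem integral_comp_sin_rpow {p : ℝ} (hp : 1 < p) (G : ℝ → ℝ) :
    ∫ θ in (0 : ℝ)..(Real.pi / 2),
      G (Real.sin θ ^ (2 / (p + 1))) * Real.sin θ ^ ((1 - p) / (p + 1)) =
    (p + 1) / 2 * ∫ s in Ioo (0 : ℝ) 1, G s * weight p s := by
  have hpi : (0 : ℝ) < Real.pi / 2 := by positivity
  have hp1 : 0 < p + 1 := by linarith
  have hr : 0 < 2 / (p + 1) := by positivity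
  rw [intervalIntegral_eq_setIntegral_Ioo hpi.le]
  have hsin : ∀ θ ∈ Ioo 0 (Real.pi / 2), 0 < Real.sin θ ∧ Real.sin θ < 1 ∧ 0 < Real.cos θ := by
    intro θ hθ
    have hc := Real.cos_pos_of_mem_Ioo ⟨by linarith [hθ.1], hθ.2⟩
    refine ⟨Real.sin_pos_of_pos_of_lt_pi hθ.1 (by linarith [hθ.2]), ?_, hc⟩
    nlinarith [Real.sin_sq_add_cos_sq θ, Real.sin_le_one θ]
  have himg : (fun θ => Real.sin θ ^ (2 / (p + 1))) '' Ioo 0 (Real.pi / 2) = Ioo (0 : ℝ) 1 := by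
    ext s
    constructor
    · rintro ⟨θ, hθ, rfl⟩
      obtain ⟨h0, h1, -⟩ := hsin θ hθ
      exact ⟨Real.rpow_pos_of_pos h0 _, Real.rpow_lt_one h0.le h1 hr⟩
    · intro hs
      have h0 : 0 < s ^ ((p + 1) / 2) := Real.rpow_pos_of_pos hs.1 _
      have h1 : s ^ ((p + 1) / 2) < 1 := Real.rpow_lt_one hs.1.le hs.2 (by positivity)
      refine ⟨Real.arcsin (s ^ ((p + 1) / 2)), ⟨Real.arcsin_pos.2 h0, ?_⟩, ?_⟩
      · exact Real.arcsin_lt_pi_div_two.2 h1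
      · simp only
        rw [Real.sin_arcsin (by linarith) h1.le, ← Real.rpow_mul hs.1.le,
          show (p + 1) / 2 * (2 / (p + 1)) = 1 by field_simp, Real.rpow_one]
  have hinj : InjOn (fun θ => Real.sin θ ^ (2 / (p + 1))) (Ioo 0 (Real.pi / 2)) := by
    intro x hx y hy hxy
    have h := (Real.rpow_left_inj (hsin x hx).1.le (hsin y hy).1.le hr.ne').1 hxy
    exact Real.injOn_sin ⟨by linarith [hx.1], hx.2.le⟩ ⟨by linarith [hy.1], hy.2.le⟩ h
  have hder : ∀ θ ∈ Ioo 0 (Real.pi / 2),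
      HasDerivWithinAt (fun θ => Real.sin θ ^ (2 / (p + 1)))
        (Real.cos θ * (2 / (p + 1)) * Real.sin θ ^ (2 / (p + 1) - 1)) (Ioo 0 (Real.pi / 2)) θ :=
    fun θ hθ => ((Real.hasDerivAt_sin θ).rpow_const
      (Or.inl (hsin θ hθ).1.ne')).hasDerivWithinAt
  have h := integral_image_eq_integral_abs_deriv_smul measurableSet_Ioo hder hinj
    (fun s => G s * weight p s)
  rw [himg] at h
  rw [h, ← integral_const_mul]
  refine setIntegral_congr_fun measurableSet_Ioo fun θ hθ => ?_
  obtain ⟨h0, h1, hc⟩ := hsin θ hθ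
  have hpos := Real.rpow_pos_of_pos h0 (2 / (p + 1) - 1)
  have hgap : gap p (Real.sin θ ^ (2 / (p + 1))) = Real.cos θ ^ 2 := by
    rw [gap, ← Real.rpow_mul h0.le, show 2 / (p + 1) * (p + 1) = 2 by field_simp, Real.rpow_two,
      ← Real.cos_sq']
  simp only [smul_eq_mul]
  rw [abs_of_pos (by positivity), weight, hgap, Real.sqrt_sq hc.le,
    show (1 - p) / (p + 1) = 2 / (p + 1) - 1 by field_simp; ring]
  field_simp

theorem integral_mul_sub_mul_sub_mul {μ : Measure ℝ} {f g h : ℝ → ℝ} (hf : Integrable f μ)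
    (hg : Integrable g μ) (hh : Integrable h μ) (a b c : ℝ) :
    ∫ s, (a * f s - b * g s - c * h s) ∂μ =
      a * (∫ s, f s ∂μ) - b * (∫ s, g s ∂μ) - c * ∫ s, h s ∂μ := by
  have h1 : Integrable (fun s => a * f s - b * g s) μ := (hf.const_mul a).sub (hg.const_mul b)
  rw [integral_sub h1 (hh.const_mul c), integral_sub (hf.const_mul a) (hg.const_mul b),
    integral_const_mul, integral_const_mul, integral_const_mul]

/-! ### Integration by parts against the weight -/

theorem hasDerivAt_weight {p s : ℝ} (hp : 1 < p) (hs : s ∈ Ioo (0 : ℝ) 1) :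
    HasDerivAt (weight p) ((p + 1) / 2 * s ^ p / gap p s * weight p s) s := by
  have hg := gap_pos hp hs
  have h := ((hasDerivAt_gap (p := p) hs.1).sqrt hg.ne').inv (Real.sqrt_pos.2 hg).ne'
  have heq : weight p = (fun y => √(gap p y))⁻¹ := by
    ext y; simp [weight]
  have hs0 := (Real.sqrt_pos.2 hg).ne'
  have hval : (p + 1) / 2 * s ^ p / gap p s * weight p s =
      -(-((p + 1) * s ^ p) / (2 * √(gap p s))) / √(gap p s) ^ 2 := by
    rw [Real.sq_sqrt hg.le, weight]
    field_simp
  rw [hval, heq]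
  exact h

theorem rpow_mul_self {p s : ℝ} (hs : 0 < s) : s ^ p * s = 1 - gap p s := by
  rw [gap, Real.rpow_add hs, Real.rpow_one]; ring

theorem integral_eq_zero_of_abs_le {p : ℝ} (hp : 1 < p) {f f' : ℝ → ℝ}
    (hf : ∀ s ∈ Ioo (0 : ℝ) 1, HasDerivAt f (f' s) s) (hint : IntegrableOn f' (Ioo 0 1))
    (hle : ∀ s ∈ Ioo (0 : ℝ) 1, |f s| ≤ s * √(gap p s)) : ∫ s in Ioo (0 : ℝ) 1, f' s = 0 := by
  have hcont : Continuous fun s => s * √(gap p s) := continuous_id.mul (continuous_gap hp).sqrt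
  have h0 : Tendsto f (𝓝[>] 0) (𝓝 0) := by
    refine squeeze_zero_norm' ?_ (((hcont.tendsto' 0 0 (by simp))).mono_left nhdsWithin_le_nhds)
    filter_upwards [Ioo_mem_nhdsGT one_pos] with s hs using hle s hs
  have h1 : Tendsto f (𝓝[<] 1) (𝓝 0) := by
    refine squeeze_zero_norm' ?_
      (((hcont.tendsto' 1 0 (by simp [gap]))).mono_left nhdsWithin_le_nhds)
    filter_upwards [Ioo_mem_nhdsLT zero_lt_one] with s hs using hle s hs
  rw [← intervalIntegral_eq_setIntegral_Ioo zero_le_one,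
    intervalIntegral.integral_eq_sub_of_hasDerivAt_of_tendsto one_pos hf
      ((intervalIntegrable_iff_integrableOn_Ioo_of_le zero_le_one).2 hint) h0 h1, sub_zero]

/-! ### The oscillating part of the potential -/

/-- `2 ∫ t in s..1, t cos (2 α t)`, the oscillating part of the rescaled potential difference. -/
noncomputable def osc (α s : ℝ) : ℝ :=
  (Real.sin (2 * α) - s * Real.sin (2 * α * s)) / α +
    (Real.cos (2 * α) - Real.cos (2 * α * s)) / (2 * α ^ 2)

theorem continuous_osc (α : ℝ) : Continuous (osc α) := by unfold osc; fun_prop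

theorem hasDerivAt_osc {α : ℝ} (hα : 0 < α) (s : ℝ) :
    HasDerivAt (osc α) (-(2 * s * Real.cos (2 * α * s))) s := by
  have h1 : HasDerivAt (fun s : ℝ => 2 * α * s) (2 * α) s := by
    simpa using (hasDerivAt_id s).const_mul (2 * α)
  have h2 := ((((hasDerivAt_id s).mul h1.sin).const_sub (Real.sin (2 * α))).div_const α).add
    ((h1.cos.const_sub (Real.cos (2 * α))).div_const (2 * α ^ 2))
  convert! h2 using 1
  simp only [id]
  field_simp
  ring

theorem abs_osc_le {α s : ℝ} (hα : 0 < α) (hs : s ∈ Ioo (0 : ℝ) 1) :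
    |osc α s| ≤ 1 - s ^ 2 := by
  have h1 : osc α 1 = 0 := by simp [osc]
  have aux : ∀ σ : ℝ, |σ| = 1 → 0 ≤ 1 - s ^ 2 - σ * osc α s := by
    intro σ hσ
    have hd : ∀ t : ℝ, HasDerivAt (fun t => 1 - t ^ 2 - σ * osc α t)
        (-(2 * t) * (1 - σ * Real.cos (2 * α * t))) t := by
      intro t
      convert! (((hasDerivAt_id t).pow 2).const_sub 1).sub ((hasDerivAt_osc hα t).const_mul σ)
        using 1
      simp only [id]
      ring
    have hanti : AntitoneOn (fun t => 1 - t ^ 2 - σ * osc α t) (Icc 0 1) := by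
      refine antitoneOn_of_deriv_nonpos (convex_Icc 0 1)
        (fun t _ => (hd t).continuousAt.continuousWithinAt)
        (fun t _ => (hd t).differentiableAt.differentiableWithinAt) fun t ht => ?_
      rw [interior_Icc] at ht
      rw [(hd t).deriv]
      have : σ * Real.cos (2 * α * t) ≤ 1 := by
        refine (le_abs_self _).trans ?_
        rw [abs_mul, hσ, one_mul]
        exact Real.abs_cos_le_one _
      nlinarith [ht.1]
    have := hanti (Ioo_subset_Icc_self hs) (right_mem_Icc.2 zero_le_one) hs.2.le
    simp only [h1] at this
    linarith
  rw [abs_le]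
  constructor
  · have := aux (-1) (by simp); linarith
  · have := aux 1 (by simp); linarith

theorem abs_osc_le_div {α s : ℝ} (hα : 1 ≤ α) (hs : s ∈ Ioo (0 : ℝ) 1) :
    |osc α s| ≤ 3 / α := by
  have h0 : 0 < α := by linarith
  have e1 : |(Real.sin (2 * α) - s * Real.sin (2 * α * s)) / α| ≤ 2 / α := by
    rw [abs_div, abs_of_pos h0]
    gcongr
    refine (abs_sub _ _).trans ?_
    rw [abs_mul, abs_of_pos hs.1]
    nlinarith [Real.abs_sin_le_one (2 * α), Real.abs_sin_le_one (2 * α * s), hs.1, hs.2,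
      abs_nonneg (Real.sin (2 * α * s))]
  have e2 : |(Real.cos (2 * α) - Real.cos (2 * α * s)) / (2 * α ^ 2)| ≤ 1 / α := by
    rw [abs_div, abs_of_pos (by positivity : 0 < 2 * α ^ 2), div_le_div_iff₀ (by positivity) h0]
    have : |Real.cos (2 * α) - Real.cos (2 * α * s)| ≤ 2 := by
      have h1 := Real.abs_cos_le_one (2 * α)
      have h2 := Real.abs_cos_le_one (2 * α * s)
      exact (abs_sub _ _).trans (by linarith)
    nlinarith
  calc |osc α s| ≤ 2 / α + 1 / α := (abs_add_le _ _).trans (add_le_add e1 e2)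
    _ = 3 / α := by ring

theorem abs_osc_div_gap_le {p α s : ℝ} (hp : 1 < p) (hα : 0 < α) (hs : s ∈ Ioo (0 : ℝ) 1) :
    |osc α s / gap p s| ≤ 1 := by
  have hg := gap_pos hp hs
  rw [abs_div, abs_of_pos hg, div_le_one hg]
  exact (abs_osc_le hα hs).trans (one_sub_sq_le_gap hp hs)

theorem continuousOn_div_gap {p : ℝ} (hp : 1 < p) {f : ℝ → ℝ} (hf : Continuous f) :
    ContinuousOn (fun s => f s / gap p s) (Ioo 0 1) :=
  hf.continuousOn.div (continuous_gap hp).continuousOn fun _ hs => (gap_pos hp hs).ne'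

theorem integrableOn_osc_div_gap {p α : ℝ} (hp : 1 < p) (hα : 0 < α) :
    IntegrableOn (fun s => osc α s / gap p s * weight p s) (Ioo 0 1) :=
  integrableOn_mul_weight hp (continuousOn_div_gap hp (continuous_osc α))
    fun _ hs => abs_osc_div_gap_le hp hα hs

theorem integrableOn_osc {p α : ℝ} (hp : 1 < p) (hα : 0 < α) :
    IntegrableOn (fun s => osc α s * weight p s) (Ioo 0 1) :=
  integrableOn_mul_weight hp (continuous_osc α).continuousOn (C := 1)
    fun _ hs => (abs_osc_le hα hs).trans (by nlinarith [sq_nonneg (1 : ℝ)])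

theorem integral_osc_div_gap {p α : ℝ} (hp : 1 < p) (hα : 0 < α) :
    (p + 1) / 4 * ∫ s in Ioo (0 : ℝ) 1, osc α s / gap p s * weight p s =
      (∫ s in Ioo (0 : ℝ) 1, s ^ 2 * Real.cos (2 * α * s) * weight p s) +
        (p - 1) / 4 * ∫ s in Ioo (0 : ℝ) 1, osc α s * weight p s := by
  have i1 := integrableOn_osc_div_gap hp hα
  have i2 := integrableOn_osc hp hα
  have i3 : IntegrableOn (fun s => s ^ 2 * Real.cos (2 * α * s) * weight p s) (Ioo 0 1) := by
    refine integrableOn_mul_weight hp (by fun_prop) (C := 1) fun s hs => ?_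
    rw [abs_mul, abs_of_nonneg (sq_nonneg s)]
    have : s ^ 2 ≤ 1 := by nlinarith [hs.1, hs.2]
    nlinarith [Real.abs_cos_le_one (2 * α * s), abs_nonneg (Real.cos (2 * α * s)), sq_nonneg s]
  have hder : ∀ s ∈ Ioo (0 : ℝ) 1, HasDerivAt (fun s => osc α s * (s * weight p s))
      ((p + 1) / 2 * (osc α s / gap p s * weight p s) -
        2 * (s ^ 2 * Real.cos (2 * α * s) * weight p s) -
        (p - 1) / 2 * (osc α s * weight p s)) s := by
    intro s hs
    have h := (hasDerivAt_osc hα s).mul ((hasDerivAt_id s).mul (hasDerivAt_weight hp hs))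
    convert! h using 1
    have hg := (gap_pos hp hs).ne'
    have hr := rpow_mul_self (p := p) hs.1
    simp only [id, Pi.mul_apply]
    have : (p + 1) / 2 * s ^ p / gap p s * weight p s * s =
        (p + 1) / 2 * (1 - gap p s) / gap p s * weight p s := by rw [← hr]; ring
    rw [mul_comm s ((p + 1) / 2 * s ^ p / gap p s * weight p s), this]
    field_simp
    ring
  have h0 := integral_eq_zero_of_abs_le hp hder
    (((i1.const_mul _).sub (i3.const_mul _)).sub (i2.const_mul _)) fun s hs => by
      have hw := weight_pos hp hs
      rw [abs_mul, abs_of_pos (mul_pos hs.1 hw), sqrt_gap, ← mul_assoc, ← mul_assoc,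
        mul_comm _ s, mul_assoc, mul_assoc]
      have := (abs_osc_le hα hs).trans (one_sub_sq_le_gap hp hs)
      have := hs.1.le
      gcongr
  rw [integral_mul_sub_mul_sub_mul i1 i3 i2] at h0
  linarith

theorem tendsto_mul_integral_bump_cos {p : ℝ} (hp : 1 < p) :
    Tendsto (fun α => α * ∫ s in Ioo (0 : ℝ) 1, s * (1 - s) * Real.cos (2 * α * s) * weight p s)
      atTop (𝓝 0) := by
  set b : ℝ → ℝ := fun s => (1 - 2 * s) + (p + 1) / 2 * (s * s ^ p * (1 - s) / gap p s)
  have hb : IntegrableOn (fun s => b s * weight p s) (Ioo 0 1) := by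
    refine integrableOn_mul_weight hp ?_ (C := 1 + (p + 1) / 2) fun s hs => ?_
    · refine (by fun_prop : ContinuousOn (fun s : ℝ => 1 - 2 * s) _).add
        (continuousOn_const.mul (continuousOn_div_gap hp ?_))
      exact (continuous_id.mul (Real.continuous_rpow_const (by linarith))).mul (by fun_prop)
    · have hg := gap_pos hp hs
      have h1 : s * s ^ p * (1 - s) / gap p s ≤ 1 := by
        rw [div_le_one hg, mul_comm s, rpow_mul_self hs.1]
        nlinarith [gap_le_one (p := p) hs, one_sub_le_gap hp hs, hs.2]
      have h0 : 0 ≤ s * s ^ p * (1 - s) / gap p s := by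
        have := Real.rpow_nonneg hs.1.le p
        have := hs.1.le
        have := sub_nonneg.2 hs.2.le
        positivity
      refine (abs_add_le _ _).trans (add_le_add ?_ ?_)
      · rw [abs_le]; constructor <;> linarith [hs.1, hs.2]
      · rw [abs_of_nonneg (mul_nonneg (by linarith) h0)]
        exact mul_le_of_le_one_right (by linarith) h1
  have hi : ∀ α : ℝ, IntegrableOn
      (fun s => s * (1 - s) * Real.cos (2 * α * s) * weight p s) (Ioo 0 1) := by
    intro α
    refine integrableOn_mul_weight hp (by fun_prop) (C := 1) fun s hs => ?_
    rw [abs_mul]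
    refine mul_le_one₀ ?_ (abs_nonneg _) (Real.abs_cos_le_one _)
    rw [abs_le]; constructor <;> nlinarith [hs.1, hs.2]
  have hbs : ∀ α : ℝ, IntegrableOn
      (fun s => b s * weight p s * Real.sin (2 * α * s)) (Ioo 0 1) := fun α =>
    Integrable.mul_bdd (c := 1) hb (Continuous.aestronglyMeasurable (by fun_prop))
      (ae_of_all _ fun s => Real.abs_sin_le_one _)
  have key : ∀ α : ℝ, α * (∫ s in Ioo (0 : ℝ) 1, s * (1 - s) * Real.cos (2 * α * s) * weight p s) =
      -(1 / 2) * ∫ s in Ioo (0 : ℝ) 1, b s * weight p s * Real.sin (2 * α * s) := by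
    intro α
    have h0 := integral_eq_zero_of_abs_le hp
      (f := fun s => s * (1 - s) * weight p s * Real.sin (2 * α * s))
      (f' := fun s => b s * weight p s * Real.sin (2 * α * s) +
        2 * α * (s * (1 - s) * Real.cos (2 * α * s) * weight p s)) ?_
      ((hbs α).add ((hi α).const_mul _)) ?_
    · rw [integral_add (hbs α) ((hi α).const_mul _), integral_const_mul] at h0
      linarith
    · intro s hs
      have h1 : HasDerivAt (fun s : ℝ => 2 * α * s) (2 * α) s := by
        simpa using (hasDerivAt_id s).const_mul (2 * α)
      have h2 := (((hasDerivAt_id s).mul ((hasDerivAt_id s).const_sub 1)).mul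
        (hasDerivAt_weight hp hs)).mul h1.sin
      convert! h2 using 1
      simp only [id, Pi.mul_apply, b]
      ring
    · intro s hs
      have hw := weight_pos hp hs
      rw [abs_mul, abs_of_pos (mul_pos (mul_pos hs.1 (sub_pos.2 hs.2)) hw), sqrt_gap,
        ← mul_assoc]
      refine (mul_le_of_le_one_right ?_ (Real.abs_sin_le_one _)).trans ?_
      · exact (mul_pos (mul_pos hs.1 (sub_pos.2 hs.2)) hw).le
      · have := one_sub_le_gap hp hs
        have := hs.1.le
        gcongr
  refine Tendsto.congr (fun α => (key α).symm) ?_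
  have := (tendsto_setIntegral_trig hb).2.const_mul (-(1 / 2))
  rwa [mul_zero] at this

theorem tendsto_mul_integral_osc {p : ℝ} (hp : 1 < p) :
    Tendsto (fun α => α * (∫ s in Ioo (0 : ℝ) 1, osc α s * weight p s) -
      Real.sin (2 * α) * ∫ s in Ioo (0 : ℝ) 1, weight p s) atTop (𝓝 0) := by
  have hw := integrableOn_weight hp
  have hsw : IntegrableOn (fun s => s * weight p s) (Ioo 0 1) :=
    integrableOn_mul_weight hp continuousOn_id (C := 1) fun s hs => by
      rw [abs_of_pos hs.1]; exact hs.2.le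
  have h1 : ∀ α : ℝ, IntegrableOn (fun s => s * weight p s * Real.sin (2 * α * s)) (Ioo 0 1) :=
    fun α => Integrable.mul_bdd (c := 1) hsw (Continuous.aestronglyMeasurable (by fun_prop))
      (ae_of_all _ fun s => Real.abs_sin_le_one _)
  have h2 : ∀ α : ℝ, IntegrableOn (fun s => weight p s * Real.cos (2 * α * s)) (Ioo 0 1) :=
    fun α => Integrable.mul_bdd (c := 1) hw (Continuous.aestronglyMeasurable (by fun_prop))
      (ae_of_all _ fun s => Real.abs_cos_le_one _)
  have key : ∀ᶠ α : ℝ in atTop,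
      -(∫ s in Ioo (0 : ℝ) 1, s * weight p s * Real.sin (2 * α * s)) +
        1 / 2 * (1 / α * (Real.cos (2 * α) * (∫ s in Ioo (0 : ℝ) 1, weight p s))) -
        1 / 2 * (1 / α * ∫ s in Ioo (0 : ℝ) 1, weight p s * Real.cos (2 * α * s)) =
      α * (∫ s in Ioo (0 : ℝ) 1, osc α s * weight p s) -
      Real.sin (2 * α) * ∫ s in Ioo (0 : ℝ) 1, weight p s := by
    filter_upwards [eventually_gt_atTop 0] with α hα
    have : ∀ s, osc α s * weight p s =
        (1 / α * Real.sin (2 * α) + 1 / (2 * α ^ 2) * Real.cos (2 * α)) * weight p s -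
        1 / α * (s * weight p s * Real.sin (2 * α * s)) -
        1 / (2 * α ^ 2) * (weight p s * Real.cos (2 * α * s)) := by
      intro s; unfold osc; field_simp; ring
    simp_rw [this]
    rw [integral_mul_sub_mul_sub_mul hw (h1 α) (h2 α)]
    generalize ∫ s in Ioo (0 : ℝ) 1, s * weight p s * Real.sin (2 * α * s) = I
    field_simp
    ring
  refine Tendsto.congr' key ?_
  have t0 : Tendsto (fun α : ℝ => 1 / α) atTop (𝓝 0) := by
    simpa using tendsto_inv_atTop_zero (𝕜 := ℝ)
  have t1 := (tendsto_setIntegral_trig hsw).2.neg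
  have t2 := (tendsto_setIntegral_trig hw).1
  have t3 := (t0.mul t2).const_mul (1 / 2)
  have t4 : Tendsto (fun α : ℝ => 1 / 2 *
      (1 / α * (Real.cos (2 * α) * (∫ s in Ioo (0 : ℝ) 1, weight p s)))) atTop (𝓝 0) := by
    have : Tendsto (fun α : ℝ =>
      (1 / α * (Real.cos (2 * α) * (∫ s in Ioo (0 : ℝ) 1, weight p s)))) atTop (𝓝 0) := by
      refine t0.zero_mul_isBoundedUnder_le (isBoundedUnder_of ⟨|∫ s in Ioo (0 : ℝ) 1, weight p s|,
        fun α => ?_⟩)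
      simp only [Function.comp, Real.norm_eq_abs, abs_mul]
      exact mul_le_of_le_one_left (abs_nonneg _) (Real.abs_cos_le_one _)
    have h := this.const_mul (1 / 2)
    rwa [mul_zero] at h
  have h := (t1.add t4).sub t3
  simp only [mul_zero, neg_zero, add_zero, sub_zero] at h
  exact h

theorem tendsto_mul_integral_osc_div_gap {p : ℝ} (hp : 1 < p) :
    Tendsto (fun α => α * ((p + 1) / 4 * (∫ s in Ioo (0 : ℝ) 1, osc α s / gap p s * weight p s) -
        ∫ s in Ioo (0 : ℝ) 1, s * Real.cos (2 * α * s) * weight p s) -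
      (p - 1) / 4 * (Real.sin (2 * α) * ∫ s in Ioo (0 : ℝ) 1, weight p s)) atTop (𝓝 0) := by
  have h := ((tendsto_mul_integral_osc hp).const_mul ((p - 1) / 4)).sub
    (tendsto_mul_integral_bump_cos hp)
  rw [mul_zero, sub_zero] at h
  refine h.congr' ?_
  filter_upwards [eventually_gt_atTop 0] with α hα
  have i1 : IntegrableOn (fun s => s * Real.cos (2 * α * s) * weight p s) (Ioo 0 1) := by
    refine integrableOn_mul_weight hp (by fun_prop) (C := 1) fun s hs => ?_
    rw [abs_mul, abs_of_pos hs.1]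
    exact mul_le_one₀ hs.2.le (abs_nonneg _) (Real.abs_cos_le_one _)
  have i2 : IntegrableOn (fun s => s ^ 2 * Real.cos (2 * α * s) * weight p s) (Ioo 0 1) := by
    refine integrableOn_mul_weight hp (by fun_prop) (C := 1) fun s hs => ?_
    rw [abs_mul, abs_of_pos (pow_pos hs.1 2)]
    exact mul_le_one₀ (pow_le_one₀ hs.1.le hs.2.le) (abs_nonneg _) (Real.abs_cos_le_one _)
  have : ∀ s, s * (1 - s) * Real.cos (2 * α * s) * weight p s =
      s * Real.cos (2 * α * s) * weight p s - s ^ 2 * Real.cos (2 * α * s) * weight p s := by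
    intro s; ring
  simp_rw [this]
  rw [integral_sub i1 i2, integral_osc_div_gap hp hα]
  ring

/-! ### The coefficients as integrals over `(0, 1)` against the weight -/

theorem C0_eq (p : ℝ) : C0 p = ∫ s in Ioo (0 : ℝ) 1, weight p s :=
  intervalIntegral_eq_setIntegral_Ioo zero_le_one _

theorem C1_eq {p : ℝ} (hp : 1 < p) :
    C1 p = -((p + 1) / 8) * ∫ s in Ioo (0 : ℝ) 1, (1 - s ^ 2) / gap p s * weight p s := by
  rw [C1, intervalIntegral_eq_setIntegral_Ioo zero_le_one]
  congr 1
  exact setIntegral_congr_fun measurableSet_Ioo fun s hs => gap_rpow_three_halves hp hs _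

theorem C2_eq {p : ℝ} (hp : 1 < p) :
    C2 p = 3 * (p + 1) ^ 2 / 128 *
      ∫ s in Ioo (0 : ℝ) 1, ((1 - s ^ 2) / gap p s) ^ 2 * weight p s := by
  rw [C2, intervalIntegral_eq_setIntegral_Ioo zero_le_one]
  congr 1
  refine setIntegral_congr_fun measurableSet_Ioo fun s hs => ?_
  simp only [div_pow]
  exact gap_rpow_five_halves hp hs _

theorem E0_eq (p : ℝ) : E0 p = ∫ s in Ioo (0 : ℝ) 1, gap p s * weight p s := by
  rw [E0, intervalIntegral_eq_setIntegral_Ioo zero_le_one]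
  exact setIntegral_congr_fun measurableSet_Ioo fun s _ => sqrt_gap p s

theorem E1_eq (p : ℝ) :
    E1 p = (p + 1) / 8 * ∫ s in Ioo (0 : ℝ) 1, (1 - s ^ 2) * weight p s := by
  rw [E1, intervalIntegral_eq_setIntegral_Ioo zero_le_one]
  congr 1
  refine setIntegral_congr_fun measurableSet_Ioo fun s _ => ?_
  rw [weight, mul_one_div]; rfl

theorem E4_eq {p : ℝ} (hp : 1 < p) :
    E4 p = -((p + 1) ^ 2 / 128) *
      ∫ s in Ioo (0 : ℝ) 1, ((1 - s ^ 2) / gap p s) ^ 2 * gap p s * weight p s := by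
  rw [E4, intervalIntegral_eq_setIntegral_Ioo zero_le_one]
  congr 1
  refine setIntegral_congr_fun measurableSet_Ioo fun s hs => ?_
  have h := gap_rpow_three_halves hp hs ((1 - s ^ 2) ^ 2)
  rw [gap] at h
  rw [h, ← gap]
  have := (gap_pos hp hs).ne'
  field_simp

theorem rpow_three_sub_div {p x : ℝ} (hp : 1 < p) (hx : 0 < x) :
    x ^ ((3 - p) / (p + 1)) = x ^ (2 / (p + 1)) * x ^ ((1 - p) / (p + 1)) := by
  rw [← Real.rpow_add hx]
  congr 1
  have : p + 1 ≠ 0 := by linarith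
  field_simp
  ring

theorem integral_comp_sin_rpow' {p : ℝ} (hp : 1 < p) (G : ℝ → ℝ) :
    ∫ θ in (0 : ℝ)..(Real.pi / 2),
      G (Real.sin θ ^ (2 / (p + 1))) * Real.sin θ ^ ((3 - p) / (p + 1)) =
    (p + 1) / 2 * ∫ s in Ioo (0 : ℝ) 1, s * G s * weight p s := by
  rw [← integral_comp_sin_rpow hp (fun s => s * G s)]
  rw [intervalIntegral_eq_setIntegral_Ioo Real.pi_div_two_pos.le,
    intervalIntegral_eq_setIntegral_Ioo Real.pi_div_two_pos.le]
  refine setIntegral_congr_fun measurableSet_Ioo fun θ hθ => ?_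
  have h0 := Real.sin_pos_of_pos_of_lt_pi hθ.1 (by linarith [hθ.2, Real.pi_pos])
  simp only [rpow_three_sub_div hp h0]
  ring

theorem C11_eq {p : ℝ} (hp : 1 < p) (α : ℝ) :
    C11 p α = ∫ s in Ioo (0 : ℝ) 1, s * Real.cos (2 * α * s) * weight p s := by
  rw [C11, integral_comp_sin_rpow' hp (fun s => Real.cos (2 * α * s))]
  have : p + 1 ≠ 0 := by linarith
  generalize ∫ s in Ioo (0 : ℝ) 1, s * Real.cos (2 * α * s) * weight p s = I
  field_simp

theorem integrableOn_id_mul_weight {p : ℝ} (hp : 1 < p) :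
    IntegrableOn (fun s => s * weight p s) (Ioo 0 1) :=
  integrableOn_mul_weight hp continuousOn_id (C := 1) fun s hs => by
    rw [abs_of_pos hs.1]; exact hs.2.le

theorem abs_C11_le {p : ℝ} (hp : 1 < p) (α : ℝ) :
    |C11 p α| ≤ ∫ s in Ioo (0 : ℝ) 1, weight p s := by
  rw [C11_eq hp, ← Real.norm_eq_abs]
  refine norm_integral_le_of_norm_le (integrableOn_weight hp)
    (ae_restrict_of_forall_mem measurableSet_Ioo fun s hs => ?_)
  have hw := weight_pos hp hs
  rw [Real.norm_eq_abs, abs_mul, abs_mul, abs_of_pos hs.1, abs_of_pos hw]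
  exact mul_le_of_le_one_left hw.le (mul_le_one₀ hs.2.le (abs_nonneg _) (Real.abs_cos_le_one _))

theorem tendsto_C21 {p : ℝ} (hp : 1 < p) : Tendsto (C21 p) atTop (𝓝 0) := by
  have h := (tendsto_setIntegral_trig (integrableOn_id_mul_weight hp)).2.const_mul (-(1 / 2))
  rw [mul_zero] at h
  refine h.congr fun α => ?_
  rw [C21, integral_comp_sin_rpow' hp (fun s => Real.sin (2 * α * s))]
  have : p + 1 ≠ 0 := by linarith
  have e : ∀ s, s * Real.sin (2 * α * s) * weight p s =
    s * weight p s * Real.sin (2 * α * s) := fun s => by ring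
  simp_rw [e]
  generalize ∫ s in Ioo (0 : ℝ) 1, s * weight p s * Real.sin (2 * α * s) = I
  field_simp

theorem tendsto_E2 {p : ℝ} (hp : 1 < p) :
    Tendsto (fun α => E2 p α + (p + 1) / 8 * (Real.sin (2 * α) *
      ∫ s in Ioo (0 : ℝ) 1, weight p s)) atTop (𝓝 0) := by
  have h := (tendsto_setIntegral_trig (integrableOn_id_mul_weight hp)).2.const_mul ((p + 1) / 8)
  rw [mul_zero] at h
  refine h.congr fun α => ?_
  rw [E2, integral_comp_sin_rpow hp
    (fun s => Real.sin (2 * α) - s * Real.sin (2 * α * s))]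
  have i1 : IntegrableOn (fun s => s * weight p s * Real.sin (2 * α * s)) (Ioo 0 1) :=
    Integrable.mul_bdd (c := 1) (integrableOn_id_mul_weight hp)
      (Continuous.aestronglyMeasurable (by fun_prop)) (ae_of_all _ fun s => Real.abs_sin_le_one _)
  have e : ∀ s, (Real.sin (2 * α) - s * Real.sin (2 * α * s)) * weight p s =
    Real.sin (2 * α) * weight p s - s * weight p s * Real.sin (2 * α * s) := fun s => by ring
  simp_rw [e]
  rw [integral_sub ((integrableOn_weight hp).const_mul _) i1, integral_const_mul]
  ring

theorem tendsto_C12 {p : ℝ} (hp : 1 < p) :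
    Tendsto (fun α => C12 p α - (p - 1) / 4 * (Real.sin (2 * α) *
      ∫ s in Ioo (0 : ℝ) 1, weight p s)) atTop (𝓝 0) := by
  have hb : IntegrableOn (fun s => (1 - s) / gap p s * weight p s) (Ioo 0 1) := by
    refine integrableOn_mul_weight hp (continuousOn_div_gap hp (by fun_prop)) (C := 1)
      fun s hs => ?_
    have hg := gap_pos hp hs
    rw [abs_div, abs_of_pos hg, abs_of_pos (sub_pos.2 hs.2), div_le_one hg]
    exact one_sub_le_gap hp hs
  have h := ((tendsto_setIntegral_trig hb).2.const_mul ((p + 1) / 4)).sub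
    ((tendsto_setIntegral_trig (integrableOn_weight hp)).2.const_mul ((p - 1) / 4))
  rw [mul_zero, mul_zero, sub_zero] at h
  refine h.congr fun α => ?_
  rw [C12, integral_comp_sin_rpow hp (fun s => Real.sin (2 * α) - Real.sin (2 * α * s)),
    intervalIntegral_eq_setIntegral_Ioo zero_le_one]
  have i1 : IntegrableOn (fun s => weight p s * Real.sin (2 * α * s)) (Ioo 0 1) :=
    Integrable.mul_bdd (c := 1) (integrableOn_weight hp)
      (Continuous.aestronglyMeasurable (by fun_prop)) (ae_of_all _ fun s => Real.abs_sin_le_one _)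
  have e : ∀ s, (Real.sin (2 * α) - Real.sin (2 * α * s)) * weight p s =
    Real.sin (2 * α) * weight p s - weight p s * Real.sin (2 * α * s) := fun s => by ring
  have e2 : ∫ s in Ioo (0 : ℝ) 1, (1 - s) / (1 - s ^ (p + 1)) ^ (3 / 2 : ℝ) *
      Real.sin (2 * α * s) = ∫ s in Ioo (0 : ℝ) 1, (1 - s) / gap p s * weight p s *
      Real.sin (2 * α * s) := by
    refine setIntegral_congr_fun measurableSet_Ioo fun s hs => ?_
    change (1 - s) / gap p s ^ (3 / 2 : ℝ) * Real.sin (2 * α * s) = _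
    rw [gap_rpow_three_halves hp hs]
  simp_rw [e]
  rw [e2, integral_sub ((integrableOn_weight hp).const_mul _) i1, integral_const_mul]
  generalize ∫ s in Ioo (0 : ℝ) 1, weight p s * Real.sin (2 * α * s) = I
  generalize ∫ s in Ioo (0 : ℝ) 1, (1 - s) / gap p s * weight p s * Real.sin (2 * α * s) = J
  have : p + 1 ≠ 0 := by linarith
  field_simp
  ring

theorem gap_pos_of_mem_Ico {p s : ℝ} (hp : 1 < p) (hs : s ∈ Ico (0 : ℝ) 1) : 0 < gap p s := by
  rcases hs.1.eq_or_lt with rfl | h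
  · rw [gap, Real.zero_rpow (by linarith)]; norm_num
  · exact gap_pos hp ⟨h, hs.2⟩

theorem integral_one_sub_rpow_neg_three_halves {s : ℝ} (hs : s ∈ Ioo (0 : ℝ) 1) :
    ∫ y in (0 : ℝ)..s, (1 - y) ^ (-(3 / 2) : ℝ) = 2 * (1 - s) ^ (-(1 / 2) : ℝ) - 2 := by
  have hne : ∀ y ∈ uIcc 0 s, 0 < 1 - y := by
    intro y hy
    rw [uIcc_of_le hs.1.le] at hy
    linarith [hy.2, hs.2]
  rw [intervalIntegral.integral_eq_sub_of_hasDerivAt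
    (f := fun y => 2 * (1 - y) ^ (-(1 / 2) : ℝ))]
  · norm_num
  · intro y hy
    have h := (((hasDerivAt_id y).const_sub 1).rpow_const (p := -(1 / 2))
      (Or.inl (hne y hy).ne')).const_mul 2
    convert! h using 1
    norm_num
    ring
  · refine ContinuousOn.intervalIntegrable fun y hy => ?_
    exact ((continuousAt_const.sub continuousAt_id).rpow_const
      (Or.inl (hne y hy).ne')).continuousWithinAt

theorem integrableOn_primitive_C3 {p : ℝ} (hp : 1 < p) :
    IntegrableOn (fun s => ∫ y in (0 : ℝ)..s, (1 - y ^ 2) / (1 - y ^ (p + 1)) ^ (5 / 2 : ℝ))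
      (Ioo 0 1) := by
  set F : ℝ → ℝ := fun y => (1 - y ^ 2) / gap p y ^ (5 / 2 : ℝ) with hF
  have hFc : ContinuousOn F (Ico 0 1) := by
    refine ContinuousOn.div (by fun_prop)
      ((continuous_gap hp).continuousOn.rpow_const fun y hy => Or.inr (by norm_num)) ?_
    exact fun y hy => (Real.rpow_pos_of_pos (gap_pos_of_mem_Ico hp hy) _).ne'
  have hii : ∀ s ∈ Ioo (0 : ℝ) 1, IntervalIntegrable F volume 0 s := by
    intro s hs
    refine (hFc.mono ?_).intervalIntegrable
    rw [uIcc_of_le hs.1.le]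
    exact fun y hy => ⟨hy.1, hy.2.trans_lt hs.2⟩
  have hcont : ContinuousOn (fun s => ∫ y in (0 : ℝ)..s, F y) (Ioo 0 1) := by
    intro s hs
    have hd := intervalIntegral.integral_hasDerivAt_right (hii s hs)
      ((hFc.mono Ioo_subset_Ico_self).stronglyMeasurableAtFilter isOpen_Ioo s hs)
      ((hFc.mono Ioo_subset_Ico_self).continuousAt (Ioo_mem_nhds hs.1 hs.2))
    exact hd.continuousAt.continuousWithinAt
  refine ((integrableOn_rpow_one_sub (r := -(1 / 2)) (by norm_num)).const_mul 2).mono'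
    (hcont.aestronglyMeasurable measurableSet_Ioo)
    (ae_restrict_of_forall_mem measurableSet_Ioo fun s hs => ?_)
  have hle : ∀ y ∈ Ioc 0 s, ‖F y‖ ≤ (1 - y) ^ (-(3 / 2) : ℝ) := by
    intro y hy
    have hy1 : y ∈ Ioo (0 : ℝ) 1 := ⟨hy.1, hy.2.trans_lt hs.2⟩
    have hg := gap_pos hp hy1
    have h1 := one_sub_sq_le_gap hp hy1
    have h2 := one_sub_le_gap hp hy1
    have h3 : 0 < 1 - y := sub_pos.2 hy1.2
    have h0 : 0 ≤ 1 - y ^ 2 := by nlinarith [hy1.1]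
    rw [Real.norm_of_nonneg (div_nonneg h0 (Real.rpow_nonneg hg.le _)),
      Real.rpow_neg h3.le, div_le_iff₀ (Real.rpow_pos_of_pos hg _),
      show (5 / 2 : ℝ) = 1 + 3 / 2 by norm_num, Real.rpow_add hg, Real.rpow_one,
      ← div_eq_inv_mul, le_div_iff₀ (Real.rpow_pos_of_pos h3 _)]
    gcongr
  have hs0 := hs.1.le
  have h1 : IntervalIntegrable (fun y : ℝ => (1 - y) ^ (-(3 / 2) : ℝ)) volume 0 s := by
    refine ContinuousOn.intervalIntegrable fun y hy => ?_
    rw [uIcc_of_le hs0] at hy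
    exact ((continuousAt_const.sub continuousAt_id).rpow_const
      (Or.inl (by linarith [hy.2, hs.2] : (0 : ℝ) < 1 - y).ne')).continuousWithinAt
  refine (intervalIntegral.norm_integral_le_of_norm_le hs0 (ae_of_all _ hle) h1).trans ?_
  rw [integral_one_sub_rpow_neg_three_halves hs]
  linarith

theorem tendsto_C3 {p : ℝ} (hp : 1 < p) : Tendsto (C3 p) atTop (𝓝 0) := by
  have h := (tendsto_setIntegral_trig (integrableOn_primitive_C3 hp)).1.const_mul
    (-(3 / 32) * (p + 1) ^ 2)
  rw [mul_zero] at h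
  refine h.congr fun α => ?_
  rw [C3, intervalIntegral_eq_setIntegral_Ioo zero_le_one]

/-! ### Taylor bounds -/

theorem abs_inv_sqrt_one_add_sub_le {x : ℝ} (hx : 0 ≤ x) :
    |1 / √(1 + x) - (1 - x / 2 + 3 * x ^ 2 / 8)| ≤ x ^ 3 := by
  obtain ⟨u, hu, rfl⟩ : ∃ u, 0 ≤ u ∧ x = u ^ 2 + 2 * u := by
    refine ⟨√(1 + x) - 1, sub_nonneg.2 (Real.one_le_sqrt.2 (by linarith)), ?_⟩
    nlinarith [Real.sq_sqrt (by linarith : 0 ≤ 1 + x)]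
  rw [show 1 + (u ^ 2 + 2 * u) = (1 + u) ^ 2 by ring, Real.sqrt_sq (by linarith)]
  have h1 : 0 < 1 + u := by linarith
  have e : 1 / (1 + u) - (1 - (u ^ 2 + 2 * u) / 2 + 3 * (u ^ 2 + 2 * u) ^ 2 / 8) =
      -(u ^ 3 * (20 + 15 * u + 3 * u ^ 2) / 8 / (1 + u)) := by
    field_simp; ring
  rw [e, abs_neg, abs_of_nonneg (by positivity), div_le_iff₀ h1,
    show (u ^ 2 + 2 * u) ^ 3 * (1 + u) = u ^ 3 * ((u + 2) ^ 3 * (1 + u)) by ring, mul_div_assoc]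
  refine mul_le_mul_of_nonneg_left ?_ (by positivity)
  rw [← sub_nonneg, show (u + 2) ^ 3 * (1 + u) - (20 + 15 * u + 3 * u ^ 2) / 8 =
    11 / 2 + 145 / 8 * u + 141 / 8 * u ^ 2 + 7 * u ^ 3 + u ^ 4 by ring]
  positivity

theorem abs_sqrt_one_add_sub_le {x : ℝ} (hx : 0 ≤ x) :
    |√(1 + x) - (1 + x / 2 - x ^ 2 / 8)| ≤ x ^ 3 := by
  obtain ⟨u, hu, rfl⟩ : ∃ u, 0 ≤ u ∧ x = u ^ 2 + 2 * u := by
    refine ⟨√(1 + x) - 1, sub_nonneg.2 (Real.one_le_sqrt.2 (by linarith)), ?_⟩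
    nlinarith [Real.sq_sqrt (by linarith : 0 ≤ 1 + x)]
  rw [show 1 + (u ^ 2 + 2 * u) = (1 + u) ^ 2 by ring, Real.sqrt_sq (by linarith),
    show 1 + u - (1 + (u ^ 2 + 2 * u) / 2 - (u ^ 2 + 2 * u) ^ 2 / 8) =
      u ^ 3 * (1 / 2 + u / 8) by ring, abs_of_nonneg (by positivity),
    show (u ^ 2 + 2 * u) ^ 3 = u ^ 3 * (u + 2) ^ 3 by ring]
  refine mul_le_mul_of_nonneg_left ?_ (by positivity)
  rw [← sub_nonneg, show (u + 2) ^ 3 - (1 / 2 + u / 8) =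
    15 / 2 + 95 / 8 * u + 6 * u ^ 2 + u ^ 3 by ring]
  positivity

/-! ### The two integrals in the energy identity -/

/-- The small parameter `(p + 1) α ^ (1 - p) / 4`. -/
noncomputable def eps (p α : ℝ) : ℝ := (p + 1) / 4 * α ^ (1 - p)

/-- The relative perturbation of `1 - s ^ (p + 1)`. -/
noncomputable def ratio (p α s : ℝ) : ℝ := (1 - s ^ 2) / gap p s - osc α s / gap p s

theorem eps_pos {p α : ℝ} (hp : 1 < p) (hα : 0 < α) : 0 < eps p α :=
  mul_pos (by linarith) (Real.rpow_pos_of_pos hα _)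

theorem one_sub_sq_div_gap_mem {p s : ℝ} (hp : 1 < p) (hs : s ∈ Ioo (0 : ℝ) 1) :
    (1 - s ^ 2) / gap p s ∈ Icc (0 : ℝ) 1 := by
  have hg := gap_pos hp hs
  have h0 : 0 ≤ 1 - s ^ 2 := by nlinarith [hs.1, hs.2]
  exact ⟨div_nonneg h0 hg.le, (div_le_one hg).2 (one_sub_sq_le_gap hp hs)⟩

theorem ratio_mem {p α s : ℝ} (hp : 1 < p) (hα : 0 < α) (hs : s ∈ Ioo (0 : ℝ) 1) :
    ratio p α s ∈ Icc (0 : ℝ) 2 := by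
  have hg := gap_pos hp hs
  have h1 := one_sub_sq_div_gap_mem hp hs
  have h2 := abs_le.1 (abs_osc_div_gap_le hp hα hs)
  have h3 := abs_le.1 (abs_osc_le hα hs)
  refine ⟨?_, by unfold ratio; linarith [h1.2]⟩
  rw [ratio, ← sub_div]
  exact div_nonneg (by linarith) hg.le

theorem continuousOn_ratio {p : ℝ} (hp : 1 < p) (α : ℝ) :
    ContinuousOn (ratio p α) (Ioo 0 1) :=
  (continuousOn_div_gap hp (by fun_prop)).sub (continuousOn_div_gap hp (continuous_osc α))

/-- `∫ ds / √(1 - s ^ (p + 1) + …)`, proportional to the time map. -/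
noncomputable def timeInt (p α : ℝ) : ℝ :=
  ∫ s in Ioo (0 : ℝ) 1, 1 / √(1 + eps p α * ratio p α s) * weight p s

/-- `∫ √(1 - s ^ (p + 1) + …) ds`, proportional to the action. -/
noncomputable def actInt (p α : ℝ) : ℝ :=
  ∫ s in Ioo (0 : ℝ) 1, √(1 + eps p α * ratio p α s) * gap p s * weight p s

theorem abs_integral_sub_le {p : ℝ} (hp : 1 < p) {F f g h : ℝ → ℝ} {a b c K : ℝ}
    (hF : IntegrableOn F (Ioo 0 1)) (hf : IntegrableOn f (Ioo 0 1))
    (hg : IntegrableOn g (Ioo 0 1)) (hh : IntegrableOn h (Ioo 0 1))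
    (hle : ∀ s ∈ Ioo (0 : ℝ) 1, |F s - (a * f s - b * g s - c * h s)| ≤ K * weight p s) :
    |(∫ s in Ioo (0 : ℝ) 1, F s) - (a * (∫ s in Ioo (0 : ℝ) 1, f s) -
      b * (∫ s in Ioo (0 : ℝ) 1, g s) - c * ∫ s in Ioo (0 : ℝ) 1, h s)| ≤
      K * ∫ s in Ioo (0 : ℝ) 1, weight p s := by
  have hi : IntegrableOn (fun s => a * f s - b * g s - c * h s) (Ioo 0 1) :=
    ((hf.const_mul a).sub (hg.const_mul b)).sub (hh.const_mul c)
  rw [← integral_mul_sub_mul_sub_mul hf hg hh, ← integral_sub hF hi, ← integral_const_mul,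
    ← Real.norm_eq_abs]
  exact norm_integral_le_of_norm_le ((integrableOn_weight hp).const_mul K)
    (ae_restrict_of_forall_mem measurableSet_Ioo hle)

theorem one_le_one_add_eps_mul {p α s : ℝ} (hp : 1 < p) (hα : 0 < α) (hs : s ∈ Ioo (0 : ℝ) 1) :
    1 ≤ 1 + eps p α * ratio p α s := by
  have := mul_nonneg (eps_pos hp hα).le (ratio_mem hp hα hs).1
  linarith

theorem integrableOn_ratio {p α : ℝ} (hp : 1 < p) (hα : 0 < α) :
    IntegrableOn (fun s => ratio p α s * weight p s) (Ioo 0 1) :=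
  integrableOn_mul_weight hp (continuousOn_ratio hp α) fun _ hs => by
    rw [abs_of_nonneg (ratio_mem hp hα hs).1]; exact (ratio_mem hp hα hs).2

theorem sq_ratio_le {p α s : ℝ} (hp : 1 < p) (hα : 0 < α) (hs : s ∈ Ioo (0 : ℝ) 1) :
    ratio p α s ^ 2 ≤ 4 := by
  have := ratio_mem hp hα hs
  nlinarith [this.1, this.2]

theorem integrableOn_sq_ratio {p α : ℝ} (hp : 1 < p) (hα : 0 < α) :
    IntegrableOn (fun s => ratio p α s ^ 2 * weight p s) (Ioo 0 1) :=
  integrableOn_mul_weight hp ((continuousOn_ratio hp α).pow 2) fun _ hs => by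
    rw [abs_of_nonneg (sq_nonneg _)]; exact sq_ratio_le hp hα hs

theorem integrableOn_sq_ratio_mul_gap {p α : ℝ} (hp : 1 < p) (hα : 0 < α) :
    IntegrableOn (fun s => ratio p α s ^ 2 * gap p s * weight p s) (Ioo 0 1) :=
  integrableOn_mul_weight hp (((continuousOn_ratio hp α).pow 2).mul (continuous_gap hp).continuousOn)
    (C := 4) fun _ hs => by
      rw [abs_of_nonneg (mul_nonneg (sq_nonneg _) (gap_pos hp hs).le)]
      exact (mul_le_of_le_one_right (sq_nonneg _) (gap_le_one hs)).trans (sq_ratio_le hp hα hs)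

theorem integrableOn_gap {p : ℝ} (hp : 1 < p) :
    IntegrableOn (fun s => gap p s * weight p s) (Ioo 0 1) :=
  integrableOn_mul_weight hp (continuous_gap hp).continuousOn fun _ hs => by
    rw [abs_of_pos (gap_pos hp hs)]; exact gap_le_one hs

theorem integrableOn_one_sub_sq {p : ℝ} (hp : 1 < p) :
    IntegrableOn (fun s => (1 - s ^ 2) * weight p s) (Ioo 0 1) :=
  integrableOn_mul_weight hp (by fun_prop) (C := 1) fun s hs => by
    rw [abs_of_nonneg] <;> nlinarith [hs.1, hs.2]

theorem integrableOn_one_sub_sq_div_gap {p : ℝ} (hp : 1 < p) :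
    IntegrableOn (fun s => (1 - s ^ 2) / gap p s * weight p s) (Ioo 0 1) :=
  integrableOn_mul_weight hp (continuousOn_div_gap hp (by fun_prop)) (C := 1) fun s hs => by
    have := one_sub_sq_div_gap_mem hp hs
    rw [abs_of_nonneg this.1]; exact this.2

theorem abs_timeInt_sub_le {p α : ℝ} (hp : 1 < p) (hα : 0 < α) :
    |timeInt p α - ((∫ s in Ioo (0 : ℝ) 1, weight p s) -
      eps p α / 2 * (∫ s in Ioo (0 : ℝ) 1, ratio p α s * weight p s) +
      3 * eps p α ^ 2 / 8 * ∫ s in Ioo (0 : ℝ) 1, ratio p α s ^ 2 * weight p s)| ≤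
      8 * eps p α ^ 3 * ∫ s in Ioo (0 : ℝ) 1, weight p s := by
  have hε := eps_pos hp hα
  have hF : IntegrableOn (fun s => 1 / √(1 + eps p α * ratio p α s) * weight p s) (Ioo 0 1) := by
    refine integrableOn_mul_weight hp (continuousOn_const.div (continuousOn_const.add
      (continuousOn_const.mul (continuousOn_ratio hp α))).sqrt fun s hs => ?_) (C := 1)
      fun s hs => ?_
    · exact (Real.sqrt_pos.2 (one_pos.trans_le (one_le_one_add_eps_mul hp hα hs))).ne'
    · have h1 := Real.one_le_sqrt.2 (one_le_one_add_eps_mul hp hα hs)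
      rw [abs_of_pos (by positivity)]
      exact (div_le_one (by linarith)).2 h1
  have h := abs_integral_sub_le hp (a := 1) (b := eps p α / 2) (c := -(3 * eps p α ^ 2 / 8))
    (K := 8 * eps p α ^ 3) hF (integrableOn_weight hp) (integrableOn_ratio hp hα)
    (integrableOn_sq_ratio hp hα) fun s hs => by
      have hw := weight_pos hp hs
      have hr := ratio_mem hp hα hs
      have ht := abs_inv_sqrt_one_add_sub_le (mul_nonneg hε.le hr.1)
      have e : 1 / √(1 + eps p α * ratio p α s) * weight p s - (1 * weight p s -
          eps p α / 2 * (ratio p α s * weight p s) -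
          -(3 * eps p α ^ 2 / 8) * (ratio p α s ^ 2 * weight p s)) =
          (1 / √(1 + eps p α * ratio p α s) - (1 - eps p α * ratio p α s / 2 +
            3 * (eps p α * ratio p α s) ^ 2 / 8)) * weight p s := by ring
      rw [e, abs_mul, abs_of_pos hw]
      refine mul_le_mul_of_nonneg_right (ht.trans ?_) hw.le
      rw [mul_pow, mul_comm]
      have : ratio p α s ^ 3 ≤ 2 ^ 3 := pow_le_pow_left₀ hr.1 hr.2 3
      exact mul_le_mul_of_nonneg_right (by linarith) (by positivity)
  rw [one_mul, neg_mul, sub_neg_eq_add] at h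
  exact h

theorem abs_actInt_sub_le {p α : ℝ} (hp : 1 < p) (hα : 0 < α) :
    |actInt p α - ((∫ s in Ioo (0 : ℝ) 1, gap p s * weight p s) +
      eps p α / 2 * (∫ s in Ioo (0 : ℝ) 1, (1 - s ^ 2) * weight p s - osc α s * weight p s) -
      eps p α ^ 2 / 8 * ∫ s in Ioo (0 : ℝ) 1, ratio p α s ^ 2 * gap p s * weight p s)| ≤
      8 * eps p α ^ 3 * ∫ s in Ioo (0 : ℝ) 1, weight p s := by
  have hε := eps_pos hp hα
  have hF : IntegrableOn (fun s => √(1 + eps p α * ratio p α s) * gap p s * weight p s)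
      (Ioo 0 1) := by
    refine integrableOn_mul_weight hp ((continuousOn_const.add
      (continuousOn_const.mul (continuousOn_ratio hp α))).sqrt.mul
      (continuous_gap hp).continuousOn) (C := √(1 + eps p α * 2)) fun s hs => ?_
    have hg := gap_pos hp hs
    rw [abs_of_nonneg (by positivity)]
    refine (mul_le_of_le_one_right (Real.sqrt_nonneg _) (gap_le_one hs)).trans ?_
    have := (ratio_mem hp hα hs).2
    gcongr
  have h := abs_integral_sub_le hp (a := 1) (b := -(eps p α / 2)) (c := eps p α ^ 2 / 8)
    (K := 8 * eps p α ^ 3) hF (integrableOn_gap hp)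
    ((integrableOn_one_sub_sq hp).sub (integrableOn_osc hp hα))
    (integrableOn_sq_ratio_mul_gap hp hα) fun s hs => by
      have hw := weight_pos hp hs
      have hg := gap_pos hp hs
      have hr := ratio_mem hp hα hs
      have ht := abs_sqrt_one_add_sub_le (mul_nonneg hε.le hr.1)
      have e0 : (1 - s ^ 2) * weight p s - osc α s * weight p s =
          ratio p α s * gap p s * weight p s := by
        unfold ratio; field_simp
      have e : √(1 + eps p α * ratio p α s) * gap p s * weight p s - (1 * (gap p s * weight p s) -
          -(eps p α / 2) * ((1 - s ^ 2) * weight p s - osc α s * weight p s) -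
          eps p α ^ 2 / 8 * (ratio p α s ^ 2 * gap p s * weight p s)) =
          (√(1 + eps p α * ratio p α s) - (1 + eps p α * ratio p α s / 2 -
            (eps p α * ratio p α s) ^ 2 / 8)) * (gap p s * weight p s) := by rw [e0]; ring
      simp only [Pi.sub_apply]
      rw [e, abs_mul, abs_of_pos (mul_pos hg hw)]
      have : ratio p α s ^ 3 ≤ 2 ^ 3 := pow_le_pow_left₀ hr.1 hr.2 3
      refine mul_le_mul (ht.trans ?_) (mul_le_of_le_one_left hw.le (gap_le_one hs))
        (mul_pos hg hw).le (by positivity)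
      rw [mul_pow, mul_comm]
      exact mul_le_mul_of_nonneg_right (by linarith) (by positivity)
  rw [one_mul, neg_mul, sub_neg_eq_add] at h
  exact h

theorem tendsto_ratio {p s : ℝ} (hs : s ∈ Ioo (0 : ℝ) 1) :
    Tendsto (fun α => ratio p α s) atTop (𝓝 ((1 - s ^ 2) / gap p s)) := by
  have h : Tendsto (fun α => osc α s) atTop (𝓝 0) := by
    refine squeeze_zero_norm' ?_ (tendsto_const_nhds.div_atTop (a := (3 : ℝ)) tendsto_id)
    filter_upwards [eventually_ge_atTop 1] with α hα using abs_osc_le_div hα hs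
  simpa [ratio] using (h.div_const (gap p s)).const_sub ((1 - s ^ 2) / gap p s)

theorem tendsto_integral_sq_ratio {p : ℝ} (hp : 1 < p) {b : ℝ → ℝ} (hb : Continuous b)
    (hb1 : ∀ s ∈ Ioo (0 : ℝ) 1, |b s| ≤ 1) :
    Tendsto (fun α => ∫ s in Ioo (0 : ℝ) 1, ratio p α s ^ 2 * b s * weight p s) atTop
      (𝓝 (∫ s in Ioo (0 : ℝ) 1, ((1 - s ^ 2) / gap p s) ^ 2 * b s * weight p s)) := by
  refine tendsto_integral_filter_of_dominated_convergence (fun s => 4 * weight p s) ?_ ?_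
    ((integrableOn_weight hp).const_mul 4) ?_
  · exact Eventually.of_forall fun α => ContinuousOn.aestronglyMeasurable
      ((((continuousOn_ratio hp α).pow 2).mul hb.continuousOn).mul (continuousOn_weight hp))
      measurableSet_Ioo
  · filter_upwards [eventually_gt_atTop 0] with α hα
    refine ae_restrict_of_forall_mem measurableSet_Ioo fun s hs => ?_
    have hw := weight_pos hp hs
    rw [Real.norm_eq_abs, abs_mul, abs_mul, abs_of_pos hw, abs_of_nonneg (sq_nonneg _)]
    refine mul_le_mul_of_nonneg_right ?_ hw.le
    exact (mul_le_of_le_one_right (sq_nonneg _) (hb1 s hs)).trans (sq_ratio_le hp hα hs)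
  · refine ae_restrict_of_forall_mem measurableSet_Ioo fun s hs => ?_
    exact (((tendsto_ratio hs).pow 2).mul_const _).mul_const _

theorem tendsto_rpow_one_sub {p : ℝ} (hp : 1 < p) :
    Tendsto (fun α : ℝ => α ^ (1 - p)) atTop (𝓝 0) := by
  simpa using tendsto_rpow_neg_atTop (sub_pos.2 hp)

theorem rpow_sub_two_eq {p α : ℝ} (hα : 0 < α) :
    α⁻¹ = α ^ (p - 2) * α ^ (1 - p) := by
  rw [← Real.rpow_add hα, ← Real.rpow_neg_one]; congr 1; ring

theorem abs_rpow_sub_two_le {p : ℝ} (hp2 : p ≤ 2) : ∀ᶠ α : ℝ in atTop, |α ^ (p - 2)| ≤ 1 := by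
  filter_upwards [eventually_ge_atTop 1] with α hα
  rw [abs_of_nonneg (Real.rpow_nonneg (by linarith) _)]
  exact Real.rpow_le_one_of_one_le_of_nonpos hα (by linarith)

theorem tendsto_remainder {p : ℝ} (hp : 1 < p) {f : ℝ → ℝ} {W : ℝ}
    (h : ∀ α, 0 < α → |f α| ≤ 8 * eps p α ^ 3 * W) :
    Tendsto (fun α => f α / (α ^ (1 - p)) ^ 2) atTop (𝓝 0) := by
  have hlim := (tendsto_rpow_one_sub hp).const_mul (8 * ((p + 1) / 4) ^ 3 * W)
  rw [mul_zero] at hlim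
  refine squeeze_zero_norm' ?_ hlim
  filter_upwards [eventually_gt_atTop 0] with α hα
  have ha := Real.rpow_pos_of_pos hα (1 - p)
  rw [Real.norm_eq_abs, abs_div, abs_of_pos (pow_pos ha 2), div_le_iff₀ (by positivity)]
  refine (h α hα).trans_eq ?_
  unfold eps; ring

/-- The expansion of the time map. -/
theorem tendsto_timeInt {p : ℝ} (hp : 1 < p) (hp2 : p ≤ 2) :
    Tendsto (fun α => (timeInt p α - C0 p - (C1 p + 1 / 2 * C11 p α) * α ^ (1 - p)) /
      (α ^ (1 - p)) ^ 2 - (C2 p + α ^ (p - 2) * ((p - 1) / 8 * (Real.sin (2 * α) * C0 p))))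
      atTop (𝓝 0) := by
  have h1 := tendsto_remainder hp fun α hα => abs_timeInt_sub_le hp hα
  have h2 := ((tendsto_integral_sq_ratio hp (b := fun _ => 1) continuous_const
    (by simp)).const_mul (3 * (p + 1) ^ 2 / 128)).sub_const (C2 p)
  simp only [mul_one, ← C2_eq hp, sub_self] at h2
  have h3 := (bdd_le_mul_tendsto_zero' 1 (abs_rpow_sub_two_le hp2)
    (tendsto_mul_integral_osc_div_gap hp)).const_mul (1 / 2)
  rw [mul_zero] at h3
  have h := (h1.add h2).add h3
  simp only [add_zero] at h
  refine h.congr' ?_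
  filter_upwards [eventually_gt_atTop 0] with α hα
  have ha := Real.rpow_pos_of_pos hα (1 - p)
  have hinv := rpow_sub_two_eq (p := p) hα
  have e1 : ∫ s in Ioo (0 : ℝ) 1, ratio p α s * weight p s =
      (∫ s in Ioo (0 : ℝ) 1, (1 - s ^ 2) / gap p s * weight p s) -
        ∫ s in Ioo (0 : ℝ) 1, osc α s / gap p s * weight p s := by
    rw [← integral_sub (integrableOn_one_sub_sq_div_gap hp) (integrableOn_osc_div_gap hp hα)]
    simp only [ratio, sub_mul]
  rw [e1, C1_eq hp, C0_eq, ← C11_eq hp, eps]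
  generalize ∫ s in Ioo (0 : ℝ) 1, (1 - s ^ 2) / gap p s * weight p s = I1
  generalize ∫ s in Ioo (0 : ℝ) 1, osc α s / gap p s * weight p s = I2
  generalize ∫ s in Ioo (0 : ℝ) 1, ratio p α s ^ 2 * weight p s = I3
  generalize ∫ s in Ioo (0 : ℝ) 1, weight p s = W
  generalize C11 p α = c
  have hk : α ^ (p - 2) * (α * ((p + 1) / 4 * I2 - c) - (p - 1) / 4 * (Real.sin (2 * α) * W)) =
      ((p + 1) / 4 * I2 - c) / α ^ (1 - p) -
        α ^ (p - 2) * ((p - 1) / 4 * (Real.sin (2 * α) * W)) := by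
    have : α ^ (p - 2) * α = 1 / α ^ (1 - p) := by
      rw [eq_div_iff ha.ne', mul_right_comm, ← hinv, inv_mul_cancel₀ hα.ne']
    rw [mul_sub, ← mul_assoc, this]
    ring
  rw [hk]
  generalize α ^ (1 - p) = a at *
  generalize α ^ (p - 2) = κ at *
  field_simp
  ring

/-- The expansion of the action. -/
theorem tendsto_actInt {p : ℝ} (hp : 1 < p) (hp2 : p ≤ 2) :
    Tendsto (fun α => (actInt p α - E0 p - E1 p * α ^ (1 - p)) /
      (α ^ (1 - p)) ^ 2 - (E4 p - α ^ (p - 2) * ((p + 1) / 8 * (Real.sin (2 * α) * C0 p))))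
      atTop (𝓝 0) := by
  have h1 := tendsto_remainder hp fun α hα => abs_actInt_sub_le hp hα
  have h2 := ((tendsto_integral_sq_ratio hp (continuous_gap hp) fun s hs => by
    rw [abs_of_pos (gap_pos hp hs)]; exact gap_le_one hs).const_mul
      (-((p + 1) ^ 2 / 128))).sub_const (E4 p)
  simp only [← E4_eq hp, sub_self] at h2
  have h3 := (bdd_le_mul_tendsto_zero' 1 (abs_rpow_sub_two_le hp2)
    (tendsto_mul_integral_osc hp)).const_mul (-((p + 1) / 8))
  rw [mul_zero] at h3
  have h := (h1.add h2).add h3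
  simp only [add_zero] at h
  refine h.congr' ?_
  filter_upwards [eventually_gt_atTop 0] with α hα
  have ha := Real.rpow_pos_of_pos hα (1 - p)
  have hinv := rpow_sub_two_eq (p := p) hα
  rw [integral_sub (integrableOn_one_sub_sq hp) (integrableOn_osc hp hα), C0_eq, E0_eq, E1_eq, eps]
  generalize ∫ s in Ioo (0 : ℝ) 1, (1 - s ^ 2) * weight p s = I1
  generalize ∫ s in Ioo (0 : ℝ) 1, osc α s * weight p s = I2
  generalize ∫ s in Ioo (0 : ℝ) 1, ratio p α s ^ 2 * gap p s * weight p s = I3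
  generalize ∫ s in Ioo (0 : ℝ) 1, weight p s = W
  have hk : α ^ (p - 2) * (α * I2 - Real.sin (2 * α) * W) =
      I2 / α ^ (1 - p) - α ^ (p - 2) * (Real.sin (2 * α) * W) := by
    have : α ^ (p - 2) * α = 1 / α ^ (1 - p) := by
      rw [eq_div_iff ha.ne', mul_right_comm, ← hinv, inv_mul_cancel₀ hα.ne']
    rw [mul_sub, ← mul_assoc, this]
    ring
  rw [hk]
  generalize α ^ (1 - p) = a at *
  generalize α ^ (p - 2) = κ at *
  field_simp
  ring

/-- The remainder in the expansion of the energy. -/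
noncomputable def remainder (p α : ℝ) : ℝ :=
  timeInt p α * actInt p α - (G0 p + G1 p α * α ^ (1 - p) + G4 p α * α ^ (2 * (1 - p)) +
    G2 p α * α ^ (-p))

theorem remainder_isLittleO {p : ℝ} (hp : 1 < p) (hp2 : p ≤ 2) :
    remainder p =o[atTop] fun α : ℝ => α ^ (2 * (1 - p)) := by
  set x : ℝ → ℝ := fun α => (timeInt p α - C0 p - (C1 p + 1 / 2 * C11 p α) * α ^ (1 - p)) /
      (α ^ (1 - p)) ^ 2 - (C2 p + α ^ (p - 2) * ((p - 1) / 8 * (Real.sin (2 * α) * C0 p))) with hx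
  set y : ℝ → ℝ := fun α => (actInt p α - E0 p - E1 p * α ^ (1 - p)) /
      (α ^ (1 - p)) ^ 2 - (E4 p - α ^ (p - 2) * ((p + 1) / 8 * (Real.sin (2 * α) * C0 p))) with hy
  have tx : Tendsto x atTop (𝓝 0) := tendsto_timeInt hp hp2
  have ty : Tendsto y atTop (𝓝 0) := tendsto_actInt hp hp2
  set X : ℝ → ℝ := fun α =>
    C2 p + α ^ (p - 2) * ((p - 1) / 8 * (Real.sin (2 * α) * C0 p)) + x α with hX
  set Y : ℝ → ℝ := fun α =>
    E4 p - α ^ (p - 2) * ((p + 1) / 8 * (Real.sin (2 * α) * C0 p)) + y α with hY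
  have hκ := abs_rpow_sub_two_le hp2
  have hosc : ∀ r : ℝ, ∀ᶠ α : ℝ in atTop,
      |α ^ (p - 2) * (r * (Real.sin (2 * α) * C0 p))| ≤ |r| * |C0 p| := by
    intro r
    filter_upwards [hκ] with α hα
    rw [abs_mul, abs_mul, abs_mul]
    refine (mul_le_of_le_one_left (by positivity) hα).trans ?_
    gcongr
    exact mul_le_of_le_one_left (abs_nonneg _) (Real.abs_sin_le_one _)
  have hsmall : ∀ f : ℝ → ℝ, Tendsto f atTop (𝓝 0) → ∀ᶠ α in atTop, |f α| ≤ 1 := fun f hf =>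
    (hf.abs.eventually_le_const (u := 1) (by simp))
  have bX : ∀ᶠ α in atTop, |X α| ≤ |C2 p| + |(p - 1) / 8| * |C0 p| + 1 := by
    filter_upwards [hosc ((p - 1) / 8), hsmall x tx] with α h1 h2
    exact (abs_add_le _ _).trans (add_le_add ((abs_add_le _ _).trans (by gcongr)) h2)
  have bY : ∀ᶠ α in atTop, |Y α| ≤ |E4 p| + |(p + 1) / 8| * |C0 p| + 1 := by
    filter_upwards [hosc ((p + 1) / 8), hsmall y ty] with α h1 h2
    exact (abs_add_le _ _).trans (add_le_add ((abs_sub _ _).trans (by gcongr)) h2)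
  have bc : ∀ᶠ α in atTop, |C1 p + 1 / 2 * C11 p α| ≤
      |C1 p| + 1 / 2 * ∫ s in Ioo (0 : ℝ) 1, weight p s := by
    refine Eventually.of_forall fun α => (abs_add_le _ _).trans ?_
    rw [abs_mul, abs_of_pos (by norm_num : (0 : ℝ) < 1 / 2)]
    have := abs_C11_le hp α
    gcongr
  have ta := tendsto_rpow_one_sub hp
  have t1 := ty.const_mul (C0 p)
  have t2 := tx.mul_const (E0 p)
  have t3 := (tendsto_C3 hp).mul_const (E0 p)
  have t4 := bdd_le_mul_tendsto_zero' 1 hκ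
    (((((tendsto_C12 hp).add (tendsto_C21 hp)).mul_const (E0 p)).const_mul (1 / 2)).add
      ((tendsto_E2 hp).const_mul (C0 p)) |>.trans (by simp))
  have t5 := bdd_le_mul_tendsto_zero' _ bY (bdd_le_mul_tendsto_zero' _ bc ta)
  have t6 := bdd_le_mul_tendsto_zero' _ bX (ta.const_mul (E1 p) |>.trans (by simp))
  have t7 := bdd_le_mul_tendsto_zero' _ bX (bdd_le_mul_tendsto_zero' _ bY
    ((ta.mul ta).trans (by simp)))
  have t := ((((((t1.add t2).sub t3).sub t4).add t5).add t6).add t7)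
  simp only [mul_zero, zero_mul, add_zero, sub_zero] at t
  rw [isLittleO_iff_tendsto']
  · refine t.congr' ?_
    filter_upwards [eventually_gt_atTop 0] with α hα
    have ha := Real.rpow_pos_of_pos hα (1 - p)
    have e2 : α ^ (2 * (1 - p)) = (α ^ (1 - p)) ^ 2 := by
      rw [mul_comm, Real.rpow_mul hα.le, Real.rpow_two]
    have eb : α ^ (-p) = α ^ (p - 2) * (α ^ (1 - p)) ^ 2 := by
      rw [← e2, ← Real.rpow_add hα]; congr 1; ring
    have hA : timeInt p α = C0 p + (C1 p + 1 / 2 * C11 p α) * α ^ (1 - p) +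
        (α ^ (1 - p)) ^ 2 * X α := by
      simp only [hX, hx]; field_simp; ring
    have hB : actInt p α = E0 p + E1 p * α ^ (1 - p) + (α ^ (1 - p)) ^ 2 * Y α := by
      simp only [hY, hy]; field_simp; ring
    rw [remainder, hA, hB, e2, eb, G0, G1, G2, G4]
    have hxX : x α = X α - C2 p - α ^ (p - 2) * ((p - 1) / 8 * (Real.sin (2 * α) * C0 p)) := by
      simp only [hX]; ring
    have hyY : y α = Y α - E4 p + α ^ (p - 2) * ((p + 1) / 8 * (Real.sin (2 * α) * C0 p)) := by
      simp only [hY]; ring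
    rw [hxX, hyY, ← C0_eq]
    generalize X α = X'
    generalize Y α = Y'
    generalize α ^ (1 - p) = a at *
    generalize α ^ (p - 2) = κ
    field_simp
    ring
  · filter_upwards [eventually_gt_atTop 0] with α hα h
    exact absurd h (Real.rpow_pos_of_pos hα _).ne'

/-! ### The energy identity -/

/-- The nonlinearity `v ^ p + v sin² v`. -/
noncomputable def force (p v : ℝ) : ℝ := v ^ p + v * Real.sin v ^ 2

/-- A primitive of `force p`. -/
noncomputable def pot (p v : ℝ) : ℝ :=
  v ^ (p + 1) / (p + 1) + v ^ 2 / 4 - v * Real.sin (2 * v) / 4 - Real.cos (2 * v) / 8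

theorem hasDerivAt_pot {p : ℝ} (hp : 1 < p) (v : ℝ) : HasDerivAt (pot p) (force p v) v := by
  have h1 : HasDerivAt (fun s : ℝ => 2 * s) 2 v := by
    simpa using (hasDerivAt_id v).const_mul 2
  have h := (((((Real.hasDerivAt_rpow_const (x := v) (p := p + 1)
    (Or.inr (by linarith))).div_const (p + 1)).add (((hasDerivAt_id v).pow 2).div_const 4)).sub
    (((hasDerivAt_id v).mul h1.sin).div_const 4)).sub (h1.cos.div_const 8))
  convert! h using 1
  have hp1 : p + 1 ≠ 0 := by linarith
  simp only [id, force, add_sub_cancel_right, mul_div_cancel_left₀ _ hp1]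
  rw [Real.cos_two_mul, Real.sin_sq]
  norm_num
  ring

theorem force_pos {p v : ℝ} (hv : 0 < v) : 0 < force p v := by
  have := Real.rpow_pos_of_pos hv p
  unfold force
  positivity

theorem pot_sub_pot {p α s : ℝ} (hp : 1 < p) (hα : 0 < α) (hs : s ∈ Ioo (0 : ℝ) 1) :
    pot p α - pot p (α * s) =
      α ^ (p + 1) / (p + 1) * (gap p s * (1 + eps p α * ratio p α s)) := by
  have hg := (gap_pos hp hs).ne'
  have e1 : gap p s * (1 + eps p α * ratio p α s) =
      gap p s + (p + 1) / 4 * α ^ (1 - p) * (1 - s ^ 2 - osc α s) := by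
    unfold eps ratio; field_simp
  have e2 : α ^ (p + 1) * α ^ (1 - p) = α ^ 2 := by
    rw [← Real.rpow_add hα, ← Real.rpow_two]; congr 1; ring
  have hp1 : p + 1 ≠ 0 := by linarith
  have e3 : α ^ (p + 1) / (p + 1) * (gap p s * (1 + eps p α * ratio p α s)) =
      α ^ (p + 1) / (p + 1) * gap p s + α ^ 2 / 4 * (1 - s ^ 2 - osc α s) := by
    rw [e1, ← e2]; field_simp
  rw [e3, pot, pot, osc, gap, Real.mul_rpow hα.le hs.1.le, ← mul_assoc 2 α s]
  field_simp
  ring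

theorem setIntegral_Ioo_eq_mul {α : ℝ} (hα : 0 < α) (f : ℝ → ℝ) :
    ∫ y in Ioo 0 α, f y = α * ∫ s in Ioo (0 : ℝ) 1, f (α * s) := by
  rw [← intervalIntegral_eq_setIntegral_Ioo zero_le_one,
    ← intervalIntegral_eq_setIntegral_Ioo hα.le, intervalIntegral.mul_integral_comp_mul_left,
    mul_zero, mul_one]

theorem integral_inv_sqrt_pot {p α μ : ℝ} (hp : 1 < p) (hα : 0 < α) (hμ : 0 < μ) :
    ∫ y in Ioo 0 α, 1 / √(2 * μ * (pot p α - pot p y)) =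
      α * (1 / √(2 * μ * (α ^ (p + 1) / (p + 1))) * timeInt p α) := by
  rw [setIntegral_Ioo_eq_mul hα, timeInt]
  congr 1
  rw [← integral_const_mul]
  refine setIntegral_congr_fun measurableSet_Ioo fun s hs => ?_
  have hg := gap_pos hp hs
  have h1 := zero_lt_one.trans_le (one_le_one_add_eps_mul hp hα hs)
  have hK : 0 ≤ 2 * μ * (α ^ (p + 1) / (p + 1)) := by
    have := Real.rpow_pos_of_pos hα (p + 1)
    have : 0 < p + 1 := by linarith
    positivity
  simp only [pot_sub_pot hp hα hs, weight]
  rw [← mul_assoc (2 * μ), Real.sqrt_mul hK, Real.sqrt_mul hg.le]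
  simp only [one_div, mul_inv]
  ring

theorem integral_sqrt_pot {p α μ : ℝ} (hp : 1 < p) (hα : 0 < α) (hμ : 0 < μ) :
    ∫ y in Ioo 0 α, √(2 * μ * (pot p α - pot p y)) =
      α * (√(2 * μ * (α ^ (p + 1) / (p + 1))) * actInt p α) := by
  rw [setIntegral_Ioo_eq_mul hα, actInt]
  congr 1
  rw [← integral_const_mul]
  refine setIntegral_congr_fun measurableSet_Ioo fun s hs => ?_
  have hg := gap_pos hp hs
  have h1 := zero_lt_one.trans_le (one_le_one_add_eps_mul hp hα hs)
  have hK : 0 ≤ 2 * μ * (α ^ (p + 1) / (p + 1)) := by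
    have := Real.rpow_pos_of_pos hα (p + 1)
    have : 0 < p + 1 := by linarith
    positivity
  simp only [pot_sub_pot hp hα hs]
  rw [← mul_assoc (2 * μ), Real.sqrt_mul hK, Real.sqrt_mul hg.le, mul_assoc _ (gap p s),
    ← sqrt_gap]
  ring

/-- On a piece where `|v'| = g ∘ v`, both the length and `∫ v' ^ 2` are integrals over the range. -/
theorem integral_over_range {v v' g : ℝ → ℝ} {s t : Set ℝ} (hs : MeasurableSet s)
    (hd : ∀ x ∈ s, HasDerivAt v (v' x) x) (hinj : InjOn v s) (himg : v '' s = t)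
    (hg : ∀ x ∈ s, |v' x| = g (v x)) (hne : ∀ x ∈ s, v' x ≠ 0) :
    ∫ y in t, 1 / g y = volume.real s ∧ ∫ y in t, g y = ∫ x in s, v' x ^ 2 := by
  have hd' : ∀ x ∈ s, HasDerivWithinAt v (v' x) s x := fun x hx => (hd x hx).hasDerivWithinAt
  constructor
  · rw [← himg, integral_image_eq_integral_abs_deriv_smul hs hd' hinj]
    have : ∫ x in s, |v' x| • (1 / g (v x)) = ∫ x in s, (1 : ℝ) := by
      refine setIntegral_congr_fun hs fun x hx => ?_
      simp only [smul_eq_mul]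
      rw [← hg x hx, mul_one_div, div_self (abs_ne_zero.2 (hne x hx))]
    rw [this, setIntegral_const, smul_eq_mul, mul_one]
  · rw [← himg, integral_image_eq_integral_abs_deriv_smul hs hd' hinj]
    refine setIntegral_congr_fun hs fun x hx => ?_
    simp only [smul_eq_mul]
    rw [← hg x hx, ← sq, sq_abs]

namespace IsSolution

variable {p μ : ℝ} {v : ℝ → ℝ}

theorem contDiffAt (h : IsSolution p μ v) {x : ℝ} (hx : x ∈ Ioo (0 : ℝ) 1) :
    ContDiffAt ℝ 2 v x :=
  (h.contDiffOn x (Ioo_subset_Icc_self hx)).contDiffAt (Icc_mem_nhds hx.1 hx.2)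

theorem hasDerivAt (h : IsSolution p μ v) {x : ℝ} (hx : x ∈ Ioo (0 : ℝ) 1) :
    HasDerivAt v (deriv v x) x :=
  ((h.contDiffAt hx).differentiableAt (by norm_num)).hasDerivAt

theorem hasDerivAt_deriv (h : IsSolution p μ v) {x : ℝ} (hx : x ∈ Ioo (0 : ℝ) 1) :
    HasDerivAt (deriv v) (-(μ * force p (v x))) x := by
  have h1 : ContDiffAt ℝ 1 (deriv v) x := (h.contDiffAt hx).derivWithin (by norm_num)
  have h2 := (h1.differentiableAt (by norm_num)).hasDerivAt
  have h3 := h.equation x hx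
  rwa [show deriv (deriv v) x = -(μ * force p (v x)) by unfold force; linarith] at h2

theorem nonneg (h : IsSolution p μ v) {x : ℝ} (hx : x ∈ Icc (0 : ℝ) 1) : 0 ≤ v x := by
  rcases hx.1.eq_or_lt with rfl | h0
  · exact h.left.ge
  rcases hx.2.eq_or_lt with rfl | h1
  · exact h.right.ge
  exact (h.pos x ⟨h0, h1⟩).le

theorem exists_max (h : IsSolution p μ v) {α : ℝ} (hα : 0 < α) (hv : HasSupNorm v α) :
    ∃ x₀ ∈ Ioo (0 : ℝ) 1, v x₀ = α ∧ deriv v x₀ = 0 := by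
  obtain ⟨x₀, hx₀, hmax⟩ := isCompact_Icc.exists_isMaxOn (nonempty_Icc.2 zero_le_one)
    h.contDiffOn.continuousOn
  have hval : v x₀ = α := by
    refine le_antisymm ((le_abs_self _).trans (hv.1 (mem_image_of_mem _ hx₀))) (hv.2 ?_)
    rintro _ ⟨x, hx, rfl⟩
    simp only [abs_of_nonneg (h.nonneg hx)]
    exact hmax hx
  have hx₁ : x₀ ∈ Ioo (0 : ℝ) 1 := by
    refine ⟨hx₀.1.lt_of_ne ?_, hx₀.2.lt_of_ne ?_⟩
    · rintro rfl; linarith [h.left]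
    · rintro rfl; linarith [h.right]
  exact ⟨x₀, hx₁, hval, (hmax.isLocalMax (Icc_mem_nhds hx₁.1 hx₁.2)).deriv_eq_zero⟩

theorem strictAntiOn_deriv (h : IsSolution p μ v) : StrictAntiOn (deriv v) (Ioo 0 1) := by
  refine strictAntiOn_of_deriv_neg (convex_Ioo 0 1)
    (fun x hx => (h.hasDerivAt_deriv hx).continuousAt.continuousWithinAt) fun x hx => ?_
  rw [interior_Ioo] at hx
  rw [(h.hasDerivAt_deriv hx).deriv]
  exact neg_neg_of_pos (mul_pos h.mu_pos (force_pos (h.pos x hx)))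

theorem sq_deriv (hp : 1 < p) (h : IsSolution p μ v) {x₀ x : ℝ} (hx₀ : x₀ ∈ Ioo (0 : ℝ) 1)
    (h0 : deriv v x₀ = 0) (hx : x ∈ Ioo (0 : ℝ) 1) :
    deriv v x ^ 2 = 2 * μ * (pot p (v x₀) - pot p (v x)) := by
  have hd : ∀ y ∈ Ioo (0 : ℝ) 1,
      HasDerivAt (fun y => deriv v y ^ 2 + 2 * μ * pot p (v y)) 0 y := by
    intro y hy
    have h1 := ((h.hasDerivAt_deriv hy).pow 2).add
      (((hasDerivAt_pot hp (v y)).comp y (h.hasDerivAt hy)).const_mul (2 * μ))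
    refine h1.congr_deriv ?_
    push_cast
    ring
  have hc := isOpen_Ioo.is_const_of_deriv_eq_zero isPreconnected_Ioo
    (fun y hy => (hd y hy).differentiableAt.differentiableWithinAt)
    (fun y hy => (hd y hy).deriv) hx hx₀
  simp only [h0] at hc
  linarith

theorem integrableOn_sq_deriv (h : IsSolution p μ v) :
    IntegrableOn (fun x => deriv v x ^ 2) (Ioo 0 1) := by
  have hc := (h.contDiffOn.continuousOn_derivWithin (uniqueDiffOn_Icc_zero_one)
    (by norm_num)).pow 2
  refine ((hc.integrableOn_Icc).mono_set Ioo_subset_Icc_self).congr_fun (fun x hx => ?_)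
    measurableSet_Ioo
  simp only [Pi.pow_apply]
  rw [derivWithin_of_mem_nhds (Icc_mem_nhds hx.1 hx.2)]

theorem energy_eq (hp : 1 < p) (h : IsSolution p μ v) {α : ℝ} (hα : 0 < α)
    (hv : HasSupNorm v α) : energy v = 4 * α ^ 2 * (timeInt p α * actInt p α) := by
  obtain ⟨x₀, hx₀, hval, hder⟩ := h.exists_max hα hv
  have hμ := h.mu_pos
  have hcont := h.contDiffOn.continuousOn
  have hl : Ioo 0 x₀ ⊆ Ioo (0 : ℝ) 1 := Ioo_subset_Ioo_right hx₀.2.le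
  have hr : Ioo x₀ 1 ⊆ Ioo (0 : ℝ) 1 := Ioo_subset_Ioo_left hx₀.1.le
  have hpos : ∀ x ∈ Ioo 0 x₀, 0 < deriv v x := fun x hx => by
    have := h.strictAntiOn_deriv (hl hx) hx₀ hx.2
    rwa [hder] at this
  have hneg : ∀ x ∈ Ioo x₀ 1, deriv v x < 0 := fun x hx => by
    have := h.strictAntiOn_deriv hx₀ (hr hx) hx.1
    rwa [hder] at this
  have hcl : ContinuousOn v (Icc 0 x₀) := hcont.mono (Icc_subset_Icc_right hx₀.2.le)
  have hcr : ContinuousOn v (Icc x₀ 1) := hcont.mono (Icc_subset_Icc_left hx₀.1.le)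
  have hmono : StrictMonoOn v (Icc 0 x₀) := by
    refine strictMonoOn_of_deriv_pos (convex_Icc _ _) hcl fun x hx => ?_
    rw [interior_Icc] at hx
    exact hpos x hx
  have hanti : StrictAntiOn v (Icc x₀ 1) := by
    refine strictAntiOn_of_deriv_neg (convex_Icc _ _) hcr fun x hx => ?_
    rw [interior_Icc] at hx
    exact hneg x hx
  have hil : v '' Ioo 0 x₀ = Ioo 0 α := by
    refine Subset.antisymm ?_ ?_
    · rintro _ ⟨x, hx, rfl⟩
      refine ⟨h.pos x (hl hx), ?_⟩
      rw [← hval]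
      exact hmono (Ioo_subset_Icc_self hx) (right_mem_Icc.2 hx₀.1.le) hx.2
    · have := intermediate_value_Ioo hx₀.1.le hcl
      rwa [h.left, hval] at this
  have hir : v '' Ioo x₀ 1 = Ioo 0 α := by
    refine Subset.antisymm ?_ ?_
    · rintro _ ⟨x, hx, rfl⟩
      refine ⟨h.pos x (hr hx), ?_⟩
      rw [← hval]
      exact hanti (left_mem_Icc.2 hx₀.2.le) (Ioo_subset_Icc_self hx) hx.1
    · have := intermediate_value_Ioo' hx₀.2.le hcr
      rwa [h.right, hval] at this
  have hg : ∀ x ∈ Ioo (0 : ℝ) 1, |deriv v x| = √(2 * μ * (pot p α - pot p (v x))) := by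
    intro x hx
    rw [← hval, ← h.sq_deriv hp hx₀ hder hx, Real.sqrt_sq_eq_abs]
  obtain ⟨a1, a2⟩ := integral_over_range (v' := deriv v)
    (g := fun y => √(2 * μ * (pot p α - pot p y))) measurableSet_Ioo
    (fun x hx => h.hasDerivAt (hl hx)) (hmono.injOn.mono Ioo_subset_Icc_self) hil
    (fun x hx => hg x (hl hx)) fun x hx => (hpos x hx).ne'
  obtain ⟨b1, b2⟩ := integral_over_range (v' := deriv v)
    (g := fun y => √(2 * μ * (pot p α - pot p y))) measurableSet_Ioo
    (fun x hx => h.hasDerivAt (hr hx)) (hanti.injOn.mono Ioo_subset_Icc_self) hir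
    (fun x hx => hg x (hr hx)) fun x hx => (hneg x hx).ne
  have hI := h.integrableOn_sq_deriv
  have hE : energy v = (∫ x in Ioo 0 x₀, deriv v x ^ 2) + ∫ x in Ioo x₀ 1, deriv v x ^ 2 := by
    rw [energy, ← intervalIntegral_eq_setIntegral_Ioo hx₀.1.le,
      ← intervalIntegral_eq_setIntegral_Ioo hx₀.2.le]
    refine (intervalIntegral.integral_add_adjacent_intervals ?_ ?_).symm
    · exact (intervalIntegrable_iff_integrableOn_Ioo_of_le hx₀.1.le).2 (hI.mono_set hl)
    · exact (intervalIntegrable_iff_integrableOn_Ioo_of_le hx₀.2.le).2 (hI.mono_set hr)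
  have hK : 0 < √(2 * μ * (α ^ (p + 1) / (p + 1))) := by
    have := Real.rpow_pos_of_pos hα (p + 1)
    have : 0 < p + 1 := by linarith
    positivity
  rw [integral_inv_sqrt_pot hp hα hμ, Real.volume_real_Ioo_of_le hx₀.1.le] at a1
  rw [integral_inv_sqrt_pot hp hα hμ, Real.volume_real_Ioo_of_le hx₀.2.le] at b1
  rw [hE, ← a2, ← b2, integral_sqrt_pot hp hα hμ]
  generalize √(2 * μ * (α ^ (p + 1) / (p + 1))) = K at *
  have hKT : K = 2 * α * timeInt p α := by
    have : α * (1 / K * timeInt p α) = 1 / 2 := by linarith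
    field_simp at this
    linarith
  rw [hKT]
  ring

end IsSolution

/-! ### Existence -/

theorem antitoneOn_of_hasDerivAt_nonpos {f f' : ℝ → ℝ} {a b : ℝ}
    (h : ∀ t ∈ Icc a b, HasDerivAt f (f' t) t) (hf' : ∀ t ∈ Icc a b, f' t ≤ 0) :
    AntitoneOn f (Icc a b) := by
  refine antitoneOn_of_deriv_nonpos (convex_Icc a b)
    (fun t ht => (h t ht).continuousAt.continuousWithinAt)
    (fun t ht => (h t (interior_subset ht)).differentiableAt.differentiableWithinAt) fun t ht => ?_
  rw [(h t (interior_subset ht)).deriv]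
  exact hf' t (interior_subset ht)

/-- The solution of `w'' = -φ(w)`, `w(0) = α`, `w'(0) = 0` has a first zero. -/
theorem exists_first_zero {φ w z : ℝ → ℝ} {α c M t₁ T : ℝ} (hα : 0 < α) (hc : 0 < c)
    (ht₁ : 0 < t₁) (hM : M * t₁ ^ 2 ≤ α / 2) (hT : T = t₁ + α / (c * t₁))
    (hφ0 : ∀ u, 0 ≤ φ u) (hφM : ∀ u, φ u ≤ M) (hφc : ∀ u, α / 2 ≤ u → c ≤ φ u)
    (hw : ∀ t ∈ Icc 0 T, HasDerivAt w (z t) t)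
    (hz : ∀ t ∈ Icc 0 T, HasDerivAt z (-φ (w t)) t) (hw0 : w 0 = α) (hz0 : z 0 = 0) :
    ∃ τ ∈ Ioc 0 T, w τ = 0 ∧ ∀ s ∈ Ico 0 τ, 0 < w s ∧ w s ≤ α := by
  have htT : t₁ ≤ T := by
    rw [hT]
    exact le_add_of_nonneg_right (by positivity)
  have hT0 : 0 < T := ht₁.trans_le htT
  have mem0 : (0 : ℝ) ∈ Icc 0 T := ⟨le_rfl, hT0.le⟩
  have mem1 : t₁ ∈ Icc 0 T := ⟨ht₁.le, htT⟩
  have hM0 : 0 ≤ M := (hφ0 0).trans (hφM 0)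
  have hza : AntitoneOn z (Icc 0 T) :=
    antitoneOn_of_hasDerivAt_nonpos hz fun t _ => neg_nonpos.2 (hφ0 _)
  have hzn : ∀ t ∈ Icc 0 T, z t ≤ 0 := fun t ht => by
    have := hza mem0 ht ht.1
    rwa [hz0] at this
  have hwa : AntitoneOn w (Icc 0 T) := antitoneOn_of_hasDerivAt_nonpos hw hzn
  have hzlow : ∀ t ∈ Icc 0 t₁, -(M * t₁) ≤ z t := fun t ht => by
    have hanti : AntitoneOn (fun t => -z t - M * t) (Icc 0 T) := by
      refine antitoneOn_of_hasDerivAt_nonpos (f' := fun t => φ (w t) - M) (fun s hs => ?_)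
        fun s _ => sub_nonpos.2 (hφM _)
      simpa using! (hz s hs).neg.sub ((hasDerivAt_id s).const_mul M)
    have h := hanti mem0 ⟨ht.1, ht.2.trans htT⟩ ht.1
    simp only [hz0] at h
    nlinarith [ht.2]
  have hsub1 : Icc 0 t₁ ⊆ Icc 0 T := Icc_subset_Icc_right htT
  have hwlow : ∀ t ∈ Icc 0 t₁, α / 2 ≤ w t := fun t ht => by
    have hanti : AntitoneOn (fun t => -w t - M * t₁ * t) (Icc 0 t₁) := by
      refine antitoneOn_of_hasDerivAt_nonpos (f' := fun t => -z t - M * t₁) (fun s hs => ?_)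
        fun s hs => by linarith [hzlow s hs]
      simpa using! (hw s (hsub1 hs)).neg.sub ((hasDerivAt_id s).const_mul (M * t₁))
    have h := hanti (left_mem_Icc.2 ht₁.le) ht ht.1
    simp only [hw0] at h
    nlinarith [ht.2, mul_nonneg hM0 ht₁.le]
  have hz1 : z t₁ ≤ -(c * t₁) := by
    have hanti : AntitoneOn (fun t => z t + c * t) (Icc 0 t₁) := by
      refine antitoneOn_of_hasDerivAt_nonpos (f' := fun t => -φ (w t) + c) (fun s hs => ?_)
        fun s hs => by linarith [hφc _ (hwlow s hs)]
      simpa using! (hz s (hsub1 hs)).add ((hasDerivAt_id s).const_mul c)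
    have h := hanti (left_mem_Icc.2 ht₁.le) (right_mem_Icc.2 ht₁.le) ht₁.le
    simp only [hz0] at h
    linarith
  have hwT : w T ≤ 0 := by
    have hsub2 : Icc t₁ T ⊆ Icc 0 T := Icc_subset_Icc_left ht₁.le
    have hanti : AntitoneOn (fun t => w t + c * t₁ * t) (Icc t₁ T) := by
      refine antitoneOn_of_hasDerivAt_nonpos (f' := fun t => z t + c * t₁) (fun s hs => ?_)
        fun s hs => by linarith [hza mem1 (hsub2 hs) hs.1]
      simpa using! (hw s (hsub2 hs)).add ((hasDerivAt_id s).const_mul (c * t₁))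
    have h := hanti (left_mem_Icc.2 htT) (right_mem_Icc.2 htT) htT
    have h1 := hwa mem0 mem1 ht₁.le
    have h2 : c * t₁ * (T - t₁) = α := by rw [hT]; field_simp; ring
    simp only at h
    rw [hw0] at h1
    linarith
  have hcont : ContinuousOn w (Icc 0 T) := fun t ht => (hw t ht).continuousAt.continuousWithinAt
  have hcomp : IsCompact (Icc 0 T ∩ w ⁻¹' Iic 0) :=
    isCompact_Icc.of_isClosed_subset (hcont.preimage_isClosed_of_isClosed isClosed_Icc isClosed_Iic)
      inter_subset_left
  obtain ⟨τ, ⟨hτ, hτ0⟩, hmin⟩ := hcomp.exists_isLeast ⟨T, ⟨hT0.le, le_rfl⟩, hwT⟩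
  have hτ0 : w τ ≤ 0 := hτ0
  have hτpos : 0 < τ := hτ.1.lt_of_ne fun h => by rw [← h] at hτ0; linarith
  have hpos : ∀ s ∈ Ico 0 τ, 0 < w s := fun s hs => by
    by_contra! hneg
    exact (hmin ⟨⟨hs.1, hs.2.le.trans hτ.2⟩, hneg⟩).not_gt hs.2
  refine ⟨τ, ⟨hτpos, hτ.2⟩, le_antisymm hτ0 ?_, fun s hs => ⟨hpos s hs, ?_⟩⟩
  · have ht : Tendsto w (𝓝[<] τ) (𝓝 (w τ)) := (hw τ hτ).continuousAt.tendsto.mono_left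
      nhdsWithin_le_nhds
    refine ge_of_tendsto ht ?_
    filter_upwards [Ioo_mem_nhdsLT hτpos] with s hs using (hpos s ⟨hs.1.le, hs.2⟩).le
  · have := hwa mem0 ⟨hs.1, hs.2.le.trans hτ.2⟩ hs.1
    rwa [hw0] at this

/-- Global solvability of `w'' = -φ(w)` for bounded Lipschitz `φ`. -/
theorem exists_ode_solution {φ : ℝ → ℝ} {K : NNReal} (hK : LipschitzWith K φ) {M T : ℝ}
    (hT : 0 < T) (hM : ∀ u, |φ u| ≤ M) (α : ℝ) :
    ∃ w z : ℝ → ℝ, w 0 = α ∧ z 0 = 0 ∧ (∀ t ∈ Ioo (-T) T, HasDerivAt w (z t) t) ∧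
      ∀ t ∈ Ioo (-T) T, HasDerivAt z (-φ (w t)) t := by
  have hM0 : 0 ≤ M := (abs_nonneg _).trans (hM 0)
  set V : ℝ → ℝ × ℝ → ℝ × ℝ := fun _ q => (T⁻¹ * q.2, -T * φ q.1) with hV
  have hlip : LipschitzWith (max (‖T⁻¹‖₊ * 1) (‖-T‖₊ * (K * 1))) (V 0) :=
    ((lipschitzWith_smul T⁻¹).comp LipschitzWith.prod_snd).prodMk
      ((lipschitzWith_smul (-T)).comp (hK.comp LipschitzWith.prod_fst))
  have hmem : (0 : ℝ) ∈ Icc (-T) T := ⟨by linarith, hT.le⟩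
  obtain ⟨A, hA⟩ : ∃ A : NNReal, (A : ℝ) = M * T ^ 2 := ⟨⟨_, by positivity⟩, rfl⟩
  obtain ⟨L, hL⟩ : ∃ L : NNReal, (L : ℝ) = M * T := ⟨⟨_, by positivity⟩, rfl⟩
  have hPL : IsPicardLindelof V (⟨0, hmem⟩ : Icc (-T) T) (α, 0) A 0 L
      (max (‖T⁻¹‖₊ * 1) (‖-T‖₊ * (K * 1))) := by
    refine ⟨fun t _ => hlip.lipschitzOnWith, fun x _ => continuousOn_const, ?_, ?_⟩
    · intro t _ q hq
      rw [Metric.mem_closedBall, Prod.dist_eq, max_le_iff] at hq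
      have h2 : |q.2| ≤ M * T ^ 2 := by simpa [hA] using hq.2
      simp only [hV, Prod.norm_def, norm_mul, norm_inv, norm_neg, Real.norm_eq_abs, abs_of_pos hT]
      refine max_le ?_ ?_
      · rw [inv_mul_le_iff₀ hT]
        refine h2.trans_eq ?_
        rw [hL]
        ring
      · rw [mul_comm, hL]
        exact mul_le_mul_of_nonneg_right (hM _) hT.le
    · simp only [hA, hL, sub_zero, zero_sub, neg_neg, max_self, NNReal.coe_zero]
      apply le_of_eq
      ring
  obtain ⟨f, hf0, hf⟩ := hPL.exists_eq_forall_mem_Icc_hasDerivWithinAt₀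
  have hf0 : f 0 = (α, 0) := hf0
  have hd : ∀ t ∈ Ioo (-T) T, HasDerivAt f (V t (f t)) t := fun t ht =>
    (hf t (Ioo_subset_Icc_self ht)).hasDerivAt (Icc_mem_nhds ht.1 ht.2)
  refine ⟨fun t => (f t).1, fun t => T⁻¹ * (f t).2, by simp [hf0], by simp [hf0],
    fun t ht => (hd t ht).fst, fun t ht => ?_⟩
  have h2 : HasDerivAt (fun t => (f t).2) (-T * φ (f t).1) t := (hd t ht).snd
  refine (h2.const_mul T⁻¹).congr_deriv ?_
  field_simp

theorem exists_isSolution {p α : ℝ} (hp : 1 < p) (hα : 0 < α) :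
    ∃ (μ : ℝ) (v : ℝ → ℝ), IsSolution p μ v ∧ HasSupNorm v α := by
  have hp0 : 0 < p := by linarith
  have hforce : ContDiff ℝ 1 (force p) := by
    have h1 : ContDiff ℝ 1 fun x : ℝ => x ^ p := by
      exact_mod_cast Real.contDiff_rpow_const_of_le (n := 1) (by exact_mod_cast hp.le)
    unfold force
    fun_prop
  obtain ⟨K, hK⟩ := hforce.contDiffOn.exists_lipschitzOnWith (s := Icc 0 α) one_ne_zero
    (convex_Icc 0 α) isCompact_Icc
  set φ : ℝ → ℝ := fun u => force p (projIcc 0 α hα.le u) with hφ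
  have hφL : LipschitzWith (K * 1) φ := hK.to_restrict.comp (LipschitzWith.projIcc hα.le)
  have hφeq : ∀ u ∈ Icc 0 α, φ u = force p u := fun u hu => by
    simp only [hφ, projIcc_of_mem hα.le hu]
  have hφ0 : ∀ u, 0 ≤ φ u := fun u => by
    have := (projIcc 0 α hα.le u).2.1
    simp only [hφ, force]
    positivity
  set M : ℝ := α ^ p + α with hM
  have hMpos : 0 < M := by positivity
  have hφM : ∀ u, φ u ≤ M := fun u => by
    obtain ⟨h0, h1⟩ := (projIcc 0 α hα.le u).2
    simp only [hφ, force, hM]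
    generalize (projIcc 0 α hα.le u : ℝ) = y at h0 h1
    refine add_le_add (Real.rpow_le_rpow h0 h1 hp0.le) ?_
    exact (mul_le_of_le_one_right h0 (Real.sin_sq_le_one y)).trans h1
  have hφc : ∀ u, α / 2 ≤ u → (α / 2) ^ p ≤ φ u := fun u hu => by
    have h1 : α / 2 ≤ (projIcc 0 α hα.le u : ℝ) := by
      rw [coe_projIcc]
      exact le_max_of_le_right (le_min (by linarith) hu)
    simp only [hφ, force]
    generalize (projIcc 0 α hα.le u : ℝ) = y at h1
    have := Real.rpow_le_rpow (by positivity) h1 hp0.le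
    have : 0 ≤ y := by linarith
    have : 0 ≤ y * Real.sin y ^ 2 := by positivity
    linarith
  set c : ℝ := (α / 2) ^ p with hc
  have hcpos : 0 < c := by positivity
  set t₁ : ℝ := √(α / (2 * M)) with ht₁
  have ht₁pos : 0 < t₁ := by positivity
  have hMt : M * t₁ ^ 2 ≤ α / 2 := by
    rw [ht₁, Real.sq_sqrt (by positivity)]
    apply le_of_eq
    field_simp
  obtain ⟨T, hT⟩ : ∃ T, T = t₁ + α / (c * t₁) := ⟨_, rfl⟩
  have hTpos : 0 < T := by rw [hT]; positivity
  obtain ⟨w, z, hw0, hz0, hw, hz⟩ := exists_ode_solution hφL (T := T + 1) (by linarith)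
    (fun u => by rw [abs_of_nonneg (hφ0 u)]; exact hφM u) α
  have hin : ∀ t ∈ Icc 0 T, t ∈ Ioo (-(T + 1)) (T + 1) := fun t ht =>
    ⟨by linarith [ht.1], by linarith [ht.2]⟩
  have hin' : ∀ t ∈ Icc 0 T, -t ∈ Ioo (-(T + 1)) (T + 1) := fun t ht =>
    ⟨by linarith [ht.2], by linarith [ht.1]⟩
  obtain ⟨b, hb, hwb, hposb⟩ := exists_first_zero hα hcpos ht₁pos hMt hT hφ0 hφM hφc
    (fun t ht => hw t (hin t ht)) (fun t ht => hz t (hin t ht)) hw0 hz0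
  obtain ⟨a, ha, hwa, hposa⟩ := exists_first_zero (w := fun t => w (-t)) (z := fun t => -z (-t))
    hα hcpos ht₁pos hMt hT hφ0 hφM hφc
    (fun t ht => by
      simpa [Function.comp_def] using! (hw _ (hin' t ht)).comp t (hasDerivAt_neg t))
    (fun t ht => by
      simpa [Function.comp_def] using! ((hz _ (hin' t ht)).comp t (hasDerivAt_neg t)).neg)
    (by simp [hw0]) (by simp [hz0])
  have hrange : ∀ t ∈ Ioo (-a) b, 0 < w t ∧ w t ≤ α := fun t ht => by
    rcases le_total 0 t with h | h
    · exact hposb t ⟨h, ht.2⟩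
    · have := hposa (-t) ⟨by linarith, by linarith [ht.1]⟩
      simpa using this
  have hapos := ha.1
  have hbpos := hb.1
  set ℓ : ℝ := a + b with hℓ
  have hℓpos : 0 < ℓ := by linarith
  have hJ : IsOpen (Ioo (-(T + 1)) (T + 1)) := isOpen_Ioo
  have hz1 : ContDiffOn ℝ 1 z (Ioo (-(T + 1)) (T + 1)) := by
    rw [show (1 : WithTop ℕ∞) = 0 + 1 from rfl, contDiffOn_succ_iff_deriv_of_isOpen hJ]
    refine ⟨fun t ht => (hz t ht).differentiableAt.differentiableWithinAt, by simp, ?_⟩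
    rw [contDiffOn_zero]
    refine ContinuousOn.congr (f := fun t => -φ (w t)) (fun t ht => ?_) fun t ht => (hz t ht).deriv
    exact (hφL.continuous.continuousAt.comp (hw t ht).continuousAt).neg.continuousWithinAt
  have hw2 : ContDiffOn ℝ 2 w (Ioo (-(T + 1)) (T + 1)) := by
    rw [show (2 : WithTop ℕ∞) = 1 + 1 from by norm_num, contDiffOn_succ_iff_deriv_of_isOpen hJ]
    exact ⟨fun t ht => (hw t ht).differentiableAt.differentiableWithinAt, by simp,
      hz1.congr fun t ht => (hw t ht).deriv⟩
  have hmap : ∀ x ∈ Icc (0 : ℝ) 1, -a + ℓ * x ∈ Icc (-a) b := fun x hx => by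
    constructor <;> nlinarith [hx.1, hx.2]
  have hmap' : ∀ x ∈ Ioo (0 : ℝ) 1, -a + ℓ * x ∈ Ioo (-a) b := fun x hx => by
    constructor <;> nlinarith [hx.1, hx.2]
  have hsubJ : Icc (-a) b ⊆ Ioo (-(T + 1)) (T + 1) := fun t ht =>
    ⟨by linarith [ht.1, ha.2], by linarith [ht.2, hb.2]⟩
  have haff : ∀ x : ℝ, HasDerivAt (fun x => -a + ℓ * x) ℓ x := fun x => by
    simpa using ((hasDerivAt_id x).const_mul ℓ).const_add (-a)
  have hv1 : ∀ x ∈ Ioo (0 : ℝ) 1,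
      HasDerivAt (fun x => w (-a + ℓ * x)) (z (-a + ℓ * x) * ℓ) x := fun x hx =>
    (hw _ (hsubJ (hmap x (Ioo_subset_Icc_self hx)))).comp x (haff x)
  have hv2 : ∀ x ∈ Ioo (0 : ℝ) 1,
      HasDerivAt (fun x => z (-a + ℓ * x) * ℓ) (-φ (w (-a + ℓ * x)) * ℓ * ℓ) x := fun x hx =>
    ((hz _ (hsubJ (hmap x (Ioo_subset_Icc_self hx)))).comp x (haff x)).mul_const ℓ
  have hv0 : w (-a + ℓ * 0) = 0 := by simpa using hwa
  have hv1' : w (-a + ℓ * 1) = 0 := by rw [hℓ]; simpa using hwb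
  refine ⟨ℓ ^ 2, fun x => w (-a + ℓ * x), ⟨by positivity, ?_, ?_, ?_, hv0, hv1'⟩, ?_, ?_⟩
  · exact hw2.comp (by fun_prop) fun x hx => hsubJ (hmap x hx)
  · intro x hx
    have heq : deriv (fun x => w (-a + ℓ * x)) =ᶠ[𝓝 x] fun x => z (-a + ℓ * x) * ℓ := by
      filter_upwards [isOpen_Ioo.mem_nhds hx] with y hy using (hv1 y hy).deriv
    obtain ⟨h0, h1⟩ := hrange _ (hmap' x hx)
    rw [heq.deriv_eq, (hv2 x hx).deriv, hφeq _ ⟨h0.le, h1⟩, force]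
    ring
  · exact fun x hx => (hrange _ (hmap' x hx)).1
  · rintro _ ⟨x, hx, rfl⟩
    rcases hx.1.eq_or_lt with rfl | h0
    · simp only [hv0, abs_zero, hα.le]
    rcases hx.2.eq_or_lt with rfl | h1
    · simp only [hv1', abs_zero, hα.le]
    obtain ⟨h2, h3⟩ := hrange _ (hmap' x ⟨h0, h1⟩)
    simpa only [abs_of_pos h2] using h3
  · intro B hB
    have hmem : a / ℓ ∈ Icc (0 : ℝ) 1 :=
      ⟨by positivity, (div_le_one hℓpos).2 (by linarith)⟩
    have := hB (mem_image_of_mem _ hmem)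
    simp only [mul_div_cancel₀ a hℓpos.ne', neg_add_cancel, hw0] at this
    exact (le_abs_self α).trans this

end OscBif

theorem theorem1p5 :
    -- for every `α > 0` there is a solution pair with `‖v‖_∞ = α`
    (∀ p : ℝ, 1 < p → p ≤ 2 → ∀ α : ℝ, 0 < α →
      ∃ (μ : ℝ) (v : ℝ → ℝ), OscBif.IsSolution p μ v ∧ OscBif.HasSupNorm v α) ∧
    -- the case `1 < p < 2`
    (∀ p : ℝ, 1 < p → p < 2 →
      ∃ R : ℝ → ℝ, R =o[atTop] (fun α : ℝ => α ^ (2 * (1 - p))) ∧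
        ∀ α : ℝ, 0 < α → ∀ (μ : ℝ) (v : ℝ → ℝ),
          OscBif.IsSolution p μ v → OscBif.HasSupNorm v α →
          OscBif.energy v = 4 * α ^ 2 *
            (OscBif.G0 p + OscBif.G1 p α * α ^ (1 - p) + OscBif.G4 p α * α ^ (2 * (1 - p))
              + OscBif.G2 p α * α ^ (-p) + R α)) ∧
    -- the case `p = 2`
    (∃ R : ℝ → ℝ, R =o[atTop] (fun α : ℝ => α ^ (-2 : ℝ)) ∧
      ∀ α : ℝ, 0 < α → ∀ (μ : ℝ) (v : ℝ → ℝ),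
        OscBif.IsSolution 2 μ v → OscBif.HasSupNorm v α →
        OscBif.energy v = 4 * α ^ 2 *
          (OscBif.G0 2 + OscBif.G1 2 α * α ^ (-1 : ℝ)
            + (OscBif.G2 2 α + OscBif.G4 2 α) * α ^ (-2 : ℝ) + R α)) := by
  refine ⟨fun p hp _ α hα => OscBif.exists_isSolution hp hα, fun p hp hp2 =>
    ⟨OscBif.remainder p, OscBif.remainder_isLittleO hp hp2.le, fun α hα μ v h hv => ?_⟩,
    OscBif.remainder 2, ?_, fun α hα μ v h hv => ?_⟩
  · rw [h.energy_eq hp hα hv, OscBif.remainder]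
    ring
  · have := OscBif.remainder_isLittleO (p := 2) (by norm_num) le_rfl
    norm_num at this ⊢
    exact this
  · rw [h.energy_eq (by norm_num) hα hv, OscBif.remainder, show (1 - 2 : ℝ) = -1 by norm_num,
      show (2 * -1 : ℝ) = -2 by norm_num]
    ring
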